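/- Let $A$ be a finite alphabet and $\widetilde A=A\cup A^{-1}$ its involutive closure. An \emph{inverse graph} over $A$ is a directed (multi)graph $\Gamma$ with edges labelled in $\widetilde A$ and with an involution $e\mapsto e^{-1}$ on the edges, such that $e^{-1}\neq e$, $e^{-1}$ goes from the terminal vertex to the initial vertex of $e$, and the label of $e^{-1}$ is the inverse of the label of $e$; moreover $\Gamma$ is deterministic (for each vertex $v$ and each $a\in\widetilde A$ at most one edge labelled $a$ starts at $v$) and connected. Isomorphisms of such graphs are pairs of bijections of vertices and of edges that are compatible with endpoints, labels and the involution. For a vertex $x_0$ and a set $F$ of vertices, $L(\Gamma,x_0,F)\subseteq\widetilde A^*$ is the set of labels of the walks from $x_0$ to a vertex of $F$ (including the empty walk when $x_0\in F$), and $L(\Gamma,x_0)=L(\Gamma,x_0,\{x_0\})$. Let $d$ be the path metric. For a vertex $v$ with $d(x_0,v)=n$, the \emph{end-cone} $\Gamma(v,x_0)$ is the connected component containing $v$ of the subgraph of $\Gamma$ induced by the vertices at distance at least $n$ from $x_0$, and its frontier $\Delta(v,x_0)$ is the set of its vertices at distance exactly $n$ from $x_0$. An end-isomorphism between end-cones $\Gamma(v,x_0)$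 and $\Gamma(w,x_0)$ is an isomorphism that maps $\Delta(v,x_0)$ onto $\Delta(w,x_0)$. The rooted graph $(\Gamma,x_0)$ is \emph{context-free in the sense of Muller--Schupp} if, up to end-isomorphism, it has only finitely many end-cones. An \emph{inverse pushdown automaton} over $\widetilde A$ is a deterministic pushdown automaton $M=(Q,\widetilde A,\Theta,\delta,q_0,\perp,F)$ without moves on the empty word ($Q$ and $\Theta$ finite, $\delta$ a partial function from $Q\times\widetilde A\times\Theta$ to $Q\times\Theta^*$, where $\delta(q,a,x)=(p,\gamma)$ gives the steps $(q,\xi x)\vdash^{a}(p,\xi\gamma)$ for all $\xi\in\Theta^*$) such that for all configurations $c_1,c_2$ reachable from $(q_0,\perp)$ and all $a\in A$: $c_1\vdash^{a}c_2$ if and only if $c_2\vdash^{a^{-1}}c_1$. Its configurations graph $\Gamma(M)$ has as vertices the configurations reachable from $(q_0,\perp)$ and as edges labelled $a\in\widetilde A$ the steps $c_1\vdash^{a}c_2$ between them, the inverse edge being the step $c_2\vdash^{a^{-1}}c_1$. \textbf{Proposition.} Let $\Gamma$ be an inverse graph over $A$ and $x_0$ a vertex of $\Gamma$. The following conditions are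 equivalent: \begin{enumerate} \item for every non-empty finite set $F$ of vertices of $\Gamma$ the language $L(\Gamma,x_0,F)$ is context-free; \item the language $L(\Gamma,x_0)$ is context-free; \item the rooted graph $(\Gamma,x_0)$ is context-free in the sense of Muller--Schupp; \item there is an inverse pushdown automaton $M$, with initial state $q_0$ and initial stack symbol $\perp$, such that the rooted configurations graph $(\Gamma(M),(q_0,\perp))$ is isomorphic to $(\Gamma,x_0)$, by an isomorphism that maps $(q_0,\perp)$ to $x_0$; \item for every vertex $y_0$ of $\Gamma$ the rooted graph $(\Gamma,y_0)$ is context-free in the sense of Muller--Schupp. \end{enumerate} -/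

import Mathlib

/-- The involutive alphabet `A ∪ A⁻¹`: `(a, true)` is the letter `a` and `(a, false)` is the formal
inverse letter `a⁻¹`. -/
abbrev Letter (A : Type*) := A × Bool

/-- The involution `a ↦ a⁻¹` of the alphabet `A ∪ A⁻¹`. -/
def Letter.inv {A : Type*} (a : Letter A) : Letter A := (a.1, !a.2)

/-- An involutive `(A ∪ A⁻¹)`-digraph: a directed multigraph with edges labelled by letters of
`A ∪ A⁻¹`, and a fixed-point-free involution of the edges that reverses the edges and inverts the
labels. -/
structure InvolutiveGraph.{u, v, w} (A : Type u) where
  V : Type v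
  E : Type w
  src : E → V
  tgt : E → V
  lab : E → Letter A
  inv : E → E
  inv_inv : ∀ e, inv (inv e) = e
  src_inv : ∀ e, src (inv e) = tgt e
  tgt_inv : ∀ e, tgt (inv e) = src e
  lab_inv : ∀ e, lab (inv e) = (lab e).inv
  inv_ne : ∀ e, inv e ≠ e

namespace InvolutiveGraph

variable {A : Type*}

/-- `Γ.Walk x w y`: there is a walk in `Γ` from `x` to `y` labelled by the word `w`
(the empty walk at a vertex is labelled by the empty word). -/
inductive Walk (Γ : InvolutiveGraph A) : Γ.V → List (Letter A) → Γ.V → Prop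
  | nil (x : Γ.V) : Walk Γ x [] x
  | cons (e : Γ.E) {w : List (Letter A)} {y : Γ.V} :
      Walk Γ (Γ.tgt e) w y → Walk Γ (Γ.src e) (Γ.lab e :: w) y

/-- An inverse graph is an involutive graph that is deterministic and connected. -/
structure IsInverse (Γ : InvolutiveGraph A) : Prop where
  deterministic : ∀ e f : Γ.E, Γ.src e = Γ.src f → Γ.lab e = Γ.lab f → e = f
  connected : ∀ x y : Γ.V, ∃ w, Γ.Walk x w y

/-- The language `L(Γ, x₀, F)` of the labels of the walks from `x₀` to a vertex of `F`. -/
def langTo (Γ : InvolutiveGraph A) (x₀ : Γ.V) (F : Set Γ.V) : Language (Letter A) :=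
  {w | ∃ y ∈ F, Γ.Walk x₀ w y}

/-- The language `L(Γ, x₀)` of the labels of the circuits at `x₀`. -/
def lang (Γ : InvolutiveGraph A) (x₀ : Γ.V) : Language (Letter A) :=
  {w | Γ.Walk x₀ w x₀}

/-- An isomorphism of involutive graphs. -/
structure Iso (Γ Γ' : InvolutiveGraph A) where
  onV : Γ.V ≃ Γ'.V
  onE : Γ.E ≃ Γ'.E
  src_onE : ∀ e, Γ'.src (onE e) = onV (Γ.src e)
  tgt_onE : ∀ e, Γ'.tgt (onE e) = onV (Γ.tgt e)
  lab_onE : ∀ e, Γ'.lab (onE e) = Γ.lab e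
  inv_onE : ∀ e, Γ'.inv (onE e) = onE (Γ.inv e)

/-- The graph distance: the least length of a walk from `x` to `y`. -/
noncomputable def dist (Γ : InvolutiveGraph A) (x y : Γ.V) : ℕ :=
  sInf {n | ∃ w, Γ.Walk x w y ∧ w.length = n}

/-- The subgraph induced by a set `S` of vertices: its edges are the edges of `Γ` with both
endpoints in `S`. -/
def induce (Γ : InvolutiveGraph A) (S : Set Γ.V) : InvolutiveGraph A where
  V := {x : Γ.V // x ∈ S}
  E := {e : Γ.E // Γ.src e ∈ S ∧ Γ.tgt e ∈ S}
  src e := ⟨Γ.src e.1, e.2.1⟩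
  tgt e := ⟨Γ.tgt e.1, e.2.2⟩
  lab e := Γ.lab e.1
  inv e := ⟨Γ.inv e.1, by rw [Γ.src_inv, Γ.tgt_inv]; exact ⟨e.2.2, e.2.1⟩⟩
  inv_inv e := Subtype.ext (Γ.inv_inv e.1)
  src_inv e := Subtype.ext (Γ.src_inv e.1)
  tgt_inv e := Subtype.ext (Γ.tgt_inv e.1)
  lab_inv e := Γ.lab_inv e.1
  inv_ne e h := Γ.inv_ne e.1 (congrArg Subtype.val h)

/-- The vertices at distance at least `n` from `x₀`, that is, those outside the disk of center `x₀`
and radius `n - 1`. -/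
def outside (Γ : InvolutiveGraph A) (x₀ : Γ.V) (n : ℕ) : Set Γ.V :=
  {y | n ≤ Γ.dist x₀ y}

/-- The vertices of the end-cone at `v`, where `n` is the distance of `v` from `x₀`: the vertices of
the connected component of `v` in the subgraph induced by the vertices at distance at least `n`
from `x₀`. -/
def coneVerts (Γ : InvolutiveGraph A) (x₀ v : Γ.V) : Set Γ.V :=
  {y | ∃ (hy : y ∈ Γ.outside x₀ (Γ.dist x₀ v)) (w : List (Letter A)),
    (Γ.induce (Γ.outside x₀ (Γ.dist x₀ v))).Walk ⟨v, le_refl (Γ.dist x₀ v)⟩ w ⟨y, hy⟩}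

/-- The end-cone `Γ(v, x₀)`. -/
def endCone (Γ : InvolutiveGraph A) (x₀ v : Γ.V) : InvolutiveGraph A :=
  Γ.induce (Γ.coneVerts x₀ v)

/-- The frontier `Δ(v, x₀)`: the vertices of the end-cone at `v` whose distance from `x₀` equals
that of `v`. -/
def frontier (Γ : InvolutiveGraph A) (x₀ v : Γ.V) : Set (Γ.endCone x₀ v).V :=
  {y | Γ.dist x₀ (Subtype.val y) = Γ.dist x₀ v}

/-- There is an end-isomorphism between the end-cones at `v` and at `v'`, that is, an isomorphism
that maps the frontier of the first onto the frontier of the second. -/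
def EndIsomorphic (Γ : InvolutiveGraph A) (x₀ v v' : Γ.V) : Prop :=
  ∃ φ : Iso (Γ.endCone x₀ v) (Γ.endCone x₀ v'), φ.onV '' Γ.frontier x₀ v = Γ.frontier x₀ v'

/-- The rooted graph `(Γ, x₀)` is context-free in the sense of Muller and Schupp: up to
end-isomorphism there are only finitely many end-cones. -/
def IsContextFreeGraph (Γ : InvolutiveGraph A) (x₀ : Γ.V) : Prop :=
  ∃ S : Set Γ.V, S.Finite ∧ ∀ v : Γ.V, ∃ v' ∈ S, Γ.EndIsomorphic x₀ v v'

end InvolutiveGraph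

/-- A real-time deterministic pushdown automaton with input alphabet `B`. Being deterministic and
without moves on the empty word, its transition function is a partial function on
`Q × B × Θ` with values in `Q × Θ*`. Stacks are lists whose head is the top of the stack. -/
structure RealTimeDPDA (B : Type*) where
  Q : Type
  Θ : Type
  finite_Q : Finite Q
  finite_Θ : Finite Θ
  δ : Q → B → Θ → Option (Q × List Θ)
  q₀ : Q
  bot : Θ
  F : Set Q

namespace RealTimeDPDA

variable {B : Type*}

/-- Configurations: a state and the content of the stack. -/
abbrev Config (M : RealTimeDPDA B) := M.Q × List M.Θ

/-- The initial configuration `(q₀, ⊥)`. -/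
def init (M : RealTimeDPDA B) : M.Config := (M.q₀, [M.bot])

/-- One step of `M` on reading the letter `a`: if `δ(q, a, x) = (p, γ)`, the top symbol `x` of the
stack is replaced by the word `γ` and the state `q` by `p`. -/
def Step (M : RealTimeDPDA B) (c : M.Config) (a : B) (c' : M.Config) : Prop :=
  ∃ (x : M.Θ) (ξ γ : List M.Θ),
    c.2 = x :: ξ ∧ M.δ c.1 a x = some (c'.1, γ) ∧ c'.2 = γ ++ ξ

/-- The configurations that `M` reaches from the initial configuration on some input word. -/
def Reachable (M : RealTimeDPDA B) (c : M.Config) : Prop :=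
  Relation.ReflTransGen (fun c₁ c₂ => ∃ a, M.Step c₁ a c₂) M.init c

/-- `M` is an inverse pushdown automaton: on the configurations that `M` reaches, the steps on
letters of `A` and those on letters of `A⁻¹` are the reverses of each other. -/
def IsInverse {A : Type*} (M : RealTimeDPDA (Letter A)) : Prop :=
  ∀ (a : A) (c₁ c₂ : M.Config), M.Reachable c₁ → M.Reachable c₂ →
    (M.Step c₁ (a, true) c₂ ↔ M.Step c₂ (a, false) c₁)

theorem IsInverse.step_inv {A : Type*} {M : RealTimeDPDA (Letter A)} (h : M.IsInverse)
    {c₁ c₂ : M.Config} (h₁ : M.Reachable c₁) (h₂ : M.Reachable c₂) {a : Letter A}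
    (hs : M.Step c₁ a c₂) : M.Step c₂ a.inv c₁ := by
  obtain ⟨a, b⟩ := a
  cases b
  · exact (h a c₂ c₁ h₂ h₁).2 hs
  · exact (h a c₁ c₂ h₁ h₂).1 hs

/-- The configurations graph `Γ(M)` of an inverse pushdown automaton `M`: the vertices are the
configurations that `M` reaches, and there is an edge from `c` to `c'` labelled by `a` for every
step from `c` to `c'` on reading `a`. -/
def configGraph {A : Type*} (M : RealTimeDPDA (Letter A)) (h : M.IsInverse) :
    InvolutiveGraph A where
  V := {c : M.Config // M.Reachable c}
  E := {t : {c : M.Config // M.Reachable c} × Letter A × {c : M.Config // M.Reachable c} //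
    M.Step t.1.1 t.2.1 t.2.2.1}
  src t := t.1.1
  tgt t := t.1.2.2
  lab t := t.1.2.1
  inv t := ⟨(t.1.2.2, t.1.2.1.inv, t.1.1), h.step_inv t.1.1.2 t.1.2.2.2 t.2⟩
  inv_inv t := by simp [Letter.inv]
  src_inv _ := rfl
  tgt_inv _ := rfl
  lab_inv _ := rfl
  inv_ne t ht := by
    have := congrArg (fun s => s.1.2.1.2) ht
    simp [Letter.inv] at this

/-- The root `(q₀, ⊥)` of the configurations graph. -/
def configRoot {A : Type*} (M : RealTimeDPDA (Letter A)) (h : M.IsInverse) :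
    (M.configGraph h).V :=
  ⟨M.init, Relation.ReflTransGen.refl⟩

end RealTimeDPDA

/-!
The equivalence closes a cycle of three substantial implications: if the circuits at `x₀` form a
context-free language, then the graph has finitely many end-cones with respect to every root; if it
has finitely many end-cones with respect to `x₀`, then it is the configurations graph of an inverse
pushdown automaton; and the languages of a configurations graph are context-free. Throughout, a walk
in the end-cone at `b` that starts at `b` is handled through its label (`ConeWalk`): since the graph
is deterministic, the end-cone with its frontier is recovered from the words that label such walks,
from the coincidences of their ends, and from the words that lead back to the frontier
(`endIsomorphic_of_words`).

From a context-free language of circuits to finitely many end-cones, for any root `x₀`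
(`isContextFreeGraph_of_isContextFree`). A context-free language lies in a finite family `𝓛` of
languages whose words split along members of `𝓛`
(`Language.IsContextFree.exists_splitFamily`). So a circuit is a polygon with a triangulation
whose chords are languages of `𝓛`: all words of such a language join the two ends of the chord
(`Joins`), and in particular the chords have bounded length. Take a walk in an end-cone between two
vertices `v` and `c` of its frontier, and close it up through the root by walks close to geodesics.
A chord that leaves the first walk (`exists_chain`) has one end on or beyond the frontier and the
other near one of the geodesics, so both ends are near `v` or near `c`. Hence `v` and `c` are near
each other and the walk is a chain of members of `𝓛` inside a ball of fixed radius at `v`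
(`exists_chain_of_isContextFree`). Therefore finitely much information on this ball, above all which
members of `𝓛` join which of its vertices (`ballData`), determines the end-cone at `v`
(`endIsomorphic_of_ballData_eq`).

From finitely many end-cones to a pushdown automaton (`IsContextFreeGraph.exists_iso_configGraph`).
An end-isomorphism preserves distances from the frontier, so there are finitely many types of
vertices (`coneType`). The end-cones that contain a vertex `v` form a descending sequence. The stack
of `v` records, level by level, how each of them sits in the preceding one, and the state records
the position of `v` in the frontier of the last one (`encode`), both as sets of words. An edge
changes the distance from the root by at most one, and the types of the vertices show that its
effect depends only on the state and on the top of the stack (`encode_isLocalEncoding`). This makes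
the encoding the configurations graph of an automaton (`exists_iso_configGraph_of_encoding`).

From a pushdown automaton to context-free languages (`RealTimeDPDA.isContextFree_run`). This is the
triple construction: nonterminals stand for the words read between two states with given upper parts
of the stack, and a run either leaves the lower part of the stack untouched or first empties the
upper part (`RealTimeDPDA.Run.cases_append`).
-/

/-! ### Walks -/

namespace InvolutiveGraph

variable {A : Type*} {Γ Γ' : InvolutiveGraph A}

/-- `Γ.WalkIn S x w y`: there is a walk in `Γ` from `x` to `y` labelled by `w`, all of whose
vertices lie in `S`. -/
inductive WalkIn (Γ : InvolutiveGraph A) (S : Set Γ.V) : Γ.V → List (Letter A) → Γ.V → Prop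
  | nil {x : Γ.V} (hx : x ∈ S) : WalkIn Γ S x [] x
  | cons (e : Γ.E) {w : List (Letter A)} {y : Γ.V} (hx : Γ.src e ∈ S) :
      WalkIn Γ S (Γ.tgt e) w y → WalkIn Γ S (Γ.src e) (Γ.lab e :: w) y

/-- The formal inverse of a word. -/
def invWord (w : List (Letter A)) : List (Letter A) := (w.map Letter.inv).reverse

@[simp] theorem length_invWord (w : List (Letter A)) : (invWord w).length = w.length := by
  simp [invWord]

theorem invWord_cons (a : Letter A) (w : List (Letter A)) :
    invWord (a :: w) = invWord w ++ [a.inv] := by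
  simp [invWord]

namespace WalkIn

variable {S T : Set Γ.V} {x y z : Γ.V} {v w : List (Letter A)} {a : Letter A}

theorem nil_iff : Γ.WalkIn S x [] y ↔ x = y ∧ x ∈ S := by
  constructor
  · rintro ⟨⟩
    exact ⟨rfl, by assumption⟩
  · rintro ⟨rfl, h⟩
    exact .nil h

theorem cons_iff : Γ.WalkIn S x (a :: w) y ↔
    x ∈ S ∧ ∃ e, Γ.src e = x ∧ Γ.lab e = a ∧ Γ.WalkIn S (Γ.tgt e) w y := by
  constructor
  · rintro ⟨⟩
    exact ⟨by assumption, _, rfl, rfl, by assumption⟩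
  · rintro ⟨hx, e, rfl, rfl, h⟩
    exact .cons e hx h

theorem mem_left (h : Γ.WalkIn S x w y) : x ∈ S := by
  cases h <;> assumption

theorem mem_right (h : Γ.WalkIn S x w y) : y ∈ S := by
  induction h <;> assumption

theorem mono (hST : S ⊆ T) (h : Γ.WalkIn S x w y) : Γ.WalkIn T x w y := by
  induction h with
  | nil hx => exact .nil (hST hx)
  | cons e hx _ ih => exact .cons e (hST hx) ih

theorem append_iff :
    Γ.WalkIn S x (v ++ w) y ↔ ∃ z, Γ.WalkIn S x v z ∧ Γ.WalkIn S z w y := by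
  induction v generalizing x with
  | nil =>
    simp only [List.nil_append, nil_iff]
    constructor
    · intro h
      exact ⟨x, ⟨rfl, h.mem_left⟩, h⟩
    · rintro ⟨z, ⟨rfl, _⟩, h⟩
      exact h
  | cons a v ih =>
    simp only [List.cons_append, cons_iff, ih]
    constructor
    · rintro ⟨hx, e, he, ha, z, h₁, h₂⟩
      exact ⟨z, ⟨hx, e, he, ha, h₁⟩, h₂⟩
    · rintro ⟨z, ⟨hx, e, he, ha, h₁⟩, h₂⟩
      exact ⟨hx, e, he, ha, z, h₁, h₂⟩

theorem append (h₁ : Γ.WalkIn S x v y) (h₂ : Γ.WalkIn S y w z) : Γ.WalkIn S x (v ++ w) z :=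
  append_iff.2 ⟨y, h₁, h₂⟩

theorem single_iff : Γ.WalkIn S x [a] y ↔
    x ∈ S ∧ y ∈ S ∧ ∃ e, Γ.src e = x ∧ Γ.lab e = a ∧ Γ.tgt e = y := by
  simp only [cons_iff, nil_iff]
  constructor
  · rintro ⟨hx, e, he, ha, rfl, hy⟩
    exact ⟨hx, hy, e, he, ha, rfl⟩
  · rintro ⟨hx, hy, e, he, ha, rfl⟩
    exact ⟨hx, e, he, ha, rfl, hy⟩

theorem inverse (h : Γ.WalkIn S x w y) : Γ.WalkIn S y (invWord w) x := by
  induction h with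
  | nil hx => exact .nil hx
  | cons e hx hw ih =>
    rw [invWord_cons]
    refine ih.append (single_iff.2 ⟨hw.mem_left, hx, Γ.inv e, Γ.src_inv e, ?_, Γ.tgt_inv e⟩)
    exact Γ.lab_inv e

end WalkIn

theorem walk_iff_walkIn {x y : Γ.V} {w : List (Letter A)} :
    Γ.Walk x w y ↔ Γ.WalkIn Set.univ x w y := by
  constructor
  · intro h
    induction h with
    | nil x => exact .nil trivial
    | cons e _ ih => exact .cons e trivial ih
  · intro h
    induction h with
    | nil _ => exact .nil _
    | cons e _ _ ih => exact .cons e ih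

theorem WalkIn.walk {S : Set Γ.V} {x y : Γ.V} {w : List (Letter A)} (h : Γ.WalkIn S x w y) :
    Γ.Walk x w y :=
  walk_iff_walkIn.2 (h.mono (Set.subset_univ S))

namespace Walk

variable {x y z t : Γ.V} {v w : List (Letter A)} {a : Letter A}

theorem nil_iff : Γ.Walk x [] y ↔ x = y := by
  simp [walk_iff_walkIn, WalkIn.nil_iff]

theorem cons_iff : Γ.Walk x (a :: w) y ↔
    ∃ e, Γ.src e = x ∧ Γ.lab e = a ∧ Γ.Walk (Γ.tgt e) w y := by
  simp [walk_iff_walkIn, WalkIn.cons_iff]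

theorem append_iff : Γ.Walk x (v ++ w) y ↔ ∃ z, Γ.Walk x v z ∧ Γ.Walk z w y := by
  simp [walk_iff_walkIn, WalkIn.append_iff]

theorem append (h₁ : Γ.Walk x v y) (h₂ : Γ.Walk y w z) : Γ.Walk x (v ++ w) z :=
  append_iff.2 ⟨y, h₁, h₂⟩

theorem single_iff : Γ.Walk x [a] y ↔ ∃ e, Γ.src e = x ∧ Γ.lab e = a ∧ Γ.tgt e = y := by
  simp [walk_iff_walkIn, WalkIn.single_iff]

theorem edge (e : Γ.E) : Γ.Walk (Γ.src e) [Γ.lab e] (Γ.tgt e) :=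
  single_iff.2 ⟨e, rfl, rfl, rfl⟩

theorem inverse (h : Γ.Walk x w y) : Γ.Walk y (invWord w) x :=
  walk_iff_walkIn.2 (walk_iff_walkIn.1 h).inverse

/-- In a deterministic graph the end of a walk is determined by its start and its label. -/
theorem right_unique (hΓ : Γ.IsInverse) (h₁ : Γ.Walk x w y) (h₂ : Γ.Walk x w z) : y = z := by
  induction h₁ with
  | nil x => exact nil_iff.1 h₂
  | cons e _ ih =>
    obtain ⟨f, hf, hl, h⟩ := cons_iff.1 h₂
    obtain rfl := hΓ.deterministic _ _ hf hl
    exact ih h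

theorem left_unique (hΓ : Γ.IsInverse) (h₁ : Γ.Walk x w z) (h₂ : Γ.Walk y w z) : x = y :=
  right_unique hΓ h₁.inverse h₂.inverse

/-- In a deterministic graph a walk can be cut where its label is cut. -/
theorem of_append_left (hΓ : Γ.IsInverse) (h : Γ.Walk x (v ++ w) z) (hv : Γ.Walk x v y) :
    Γ.Walk y w z := by
  obtain ⟨t, h₁, h₂⟩ := append_iff.1 h
  rwa [right_unique hΓ hv h₁]

theorem of_append_right (hΓ : Γ.IsInverse) (h : Γ.Walk x (v ++ w) z) (hw : Γ.Walk y w z) :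
    Γ.Walk x v y := by
  obtain ⟨t, h₁, h₂⟩ := append_iff.1 h
  rwa [left_unique hΓ hw h₂]

end Walk

theorem WalkIn.right_unique (hΓ : Γ.IsInverse) {S T : Set Γ.V} {x y z : Γ.V}
    {w : List (Letter A)} (h₁ : Γ.WalkIn S x w y) (h₂ : Γ.WalkIn T x w z) : y = z :=
  h₁.walk.right_unique hΓ h₂.walk

open Classical in
/-- The end of the walk from `x` labelled by `w`, or `x` if there is no such walk. -/
noncomputable def walkEnd (Γ : InvolutiveGraph A) (x : Γ.V) (w : List (Letter A)) : Γ.V :=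
  if h : ∃ y, Γ.Walk x w y then h.choose else x

theorem walkEnd_eq (hΓ : Γ.IsInverse) {x y : Γ.V} {w : List (Letter A)} (h : Γ.Walk x w y) :
    Γ.walkEnd x w = y := by
  have h' : ∃ y, Γ.Walk x w y := ⟨y, h⟩
  rw [walkEnd, dif_pos h']
  exact h'.choose_spec.right_unique hΓ h

/-! ### Distance -/

section Dist

variable {x y z : Γ.V} {w : List (Letter A)} {n : ℕ}

theorem dist_le_length (h : Γ.Walk x w y) : Γ.dist x y ≤ w.length :=
  Nat.sInf_le ⟨w, h, rfl⟩

theorem exists_walk_length_eq_dist (hΓ : Γ.IsInverse) (x y : Γ.V) :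
    ∃ w, Γ.Walk x w y ∧ w.length = Γ.dist x y := by
  obtain ⟨w, hw⟩ := hΓ.connected x y
  exact Nat.sInf_mem (s := {n | ∃ w, Γ.Walk x w y ∧ w.length = n}) ⟨_, w, hw, rfl⟩

@[simp] theorem dist_self (x : Γ.V) : Γ.dist x x = 0 :=
  Nat.le_zero.1 (dist_le_length (.nil x))

theorem dist_le_dist_add_length (hΓ : Γ.IsInverse) (x₀ : Γ.V) (h : Γ.Walk x w y) :
    Γ.dist x₀ y ≤ Γ.dist x₀ x + w.length := by
  obtain ⟨v, hv, hl⟩ := exists_walk_length_eq_dist hΓ x₀ x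
  rw [← hl, ← List.length_append]
  exact dist_le_length (hv.append h)

theorem dist_le_dist_add_length' (hΓ : Γ.IsInverse) (x₀ : Γ.V) (h : Γ.Walk x w y) :
    Γ.dist x₀ x ≤ Γ.dist x₀ y + w.length := by
  simpa using dist_le_dist_add_length hΓ x₀ h.inverse

theorem dist_eq_zero (hΓ : Γ.IsInverse) : Γ.dist x y = 0 ↔ x = y := by
  constructor
  · intro h
    obtain ⟨w, hw, hl⟩ := exists_walk_length_eq_dist hΓ x y
    rw [h, List.length_eq_zero_iff] at hl
    subst hl
    exact Walk.nil_iff.1 hw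
  · rintro rfl
    exact dist_self x

/-- A geodesic from the root to `y` has a vertex on each level `n` up to that of `y`, and does not
come back below this level afterwards. -/
theorem exists_walkIn_of_le_dist (hΓ : Γ.IsInverse) (x₀ : Γ.V) (hn : n ≤ Γ.dist x₀ y) :
    ∃ x w, Γ.dist x₀ x = n ∧ Γ.WalkIn (Γ.outside x₀ n) x w y ∧ n + w.length = Γ.dist x₀ y := by
  induction h : Γ.dist x₀ y - n generalizing y with
  | zero =>
    have hy : Γ.dist x₀ y = n := by omega
    exact ⟨y, [], hy, .nil hn, by simp [hy]⟩
  | succ k ih =>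
    obtain ⟨w, hw, hl⟩ := exists_walk_length_eq_dist hΓ x₀ y
    have hne : w ≠ [] := by
      rintro rfl
      simp at hl
      omega
    obtain ⟨w, a, rfl⟩ := (List.eq_nil_or_concat w).resolve_left hne
    rw [List.concat_eq_append] at hw hl
    obtain ⟨z, h₁, h₂⟩ := Walk.append_iff.1 hw
    have e₁ := dist_le_length h₁
    have e₂ := dist_le_dist_add_length hΓ x₀ h₂
    simp only [List.length_append, List.length_singleton] at hl e₂
    have hz : Γ.dist x₀ z + 1 = Γ.dist x₀ y := by omega
    obtain ⟨x, v, hx, hv, hvl⟩ := ih (y := z) (by omega) (by omega)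
    refine ⟨x, v ++ [a], hx, hv.append ?_, by simp; omega⟩
    obtain ⟨e, he⟩ := Walk.single_iff.1 h₂
    exact WalkIn.single_iff.2 ⟨hv.mem_right, hn, e, he⟩

/-- The graph is locally finite: balls are finite. -/
theorem finite_setOf_dist_le [Finite A] (hΓ : Γ.IsInverse) (x₀ : Γ.V) (n : ℕ) :
    {y | Γ.dist x₀ y ≤ n}.Finite := by
  refine ((List.finite_length_le (Letter A) n).image (Γ.walkEnd x₀)).subset fun y hy => ?_
  obtain ⟨w, hw, hl⟩ := exists_walk_length_eq_dist hΓ x₀ y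
  exact ⟨w, hl.trans_le hy, walkEnd_eq hΓ hw⟩

end Dist

/-! ### Isomorphisms of deterministic graphs -/

/-- A label-respecting correspondence of the vertices of deterministic graphs extends to an
isomorphism. -/
theorem exists_iso_of_equiv
    (hΓ : ∀ e f : Γ.E, Γ.src e = Γ.src f → Γ.lab e = Γ.lab f → e = f)
    (hΓ' : ∀ e f : Γ'.E, Γ'.src e = Γ'.src f → Γ'.lab e = Γ'.lab f → e = f)
    (f : Γ.V ≃ Γ'.V)
    (h₁ : ∀ e, ∃ e', Γ'.src e' = f (Γ.src e) ∧ Γ'.lab e' = Γ.lab e ∧ Γ'.tgt e' = f (Γ.tgt e))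
    (h₂ : ∀ e', ∃ e, Γ'.src e' = f (Γ.src e) ∧ Γ'.lab e' = Γ.lab e ∧ Γ'.tgt e' = f (Γ.tgt e)) :
    ∃ φ : Iso Γ Γ', φ.onV = f := by
  choose g hs hl ht using h₁
  have hg : Function.Bijective g := by
    constructor
    · intro e e' h
      refine hΓ e e' (f.injective ?_) ?_
      · rw [← hs, ← hs, h]
      · rw [← hl, ← hl, h]
    · intro e'
      obtain ⟨e, h₁, h₂, _⟩ := h₂ e'
      exact ⟨e, hΓ' _ _ (by rw [hs, h₁]) (by rw [hl, h₂])⟩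
  refine ⟨⟨f, Equiv.ofBijective g hg, hs, ht, hl, ?_⟩, rfl⟩
  intro e
  refine hΓ' _ _ ?_ ?_
  · simp [Γ'.src_inv, hs, ht, Γ.src_inv]
  · simp [Γ'.lab_inv, hl, Γ.lab_inv]

/-- The inverse of an isomorphism. -/
def Iso.symm (φ : Iso Γ Γ') : Iso Γ' Γ where
  onV := φ.onV.symm
  onE := φ.onE.symm
  src_onE e := by rw [Equiv.eq_symm_apply, ← φ.src_onE, Equiv.apply_symm_apply]
  tgt_onE e := by rw [Equiv.eq_symm_apply, ← φ.tgt_onE, Equiv.apply_symm_apply]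
  lab_onE e := by rw [← φ.lab_onE, Equiv.apply_symm_apply]
  inv_onE e := by rw [Equiv.eq_symm_apply, ← φ.inv_onE, Equiv.apply_symm_apply]

theorem Walk.map (φ : Iso Γ Γ') {x y : Γ.V} {w : List (Letter A)} (h : Γ.Walk x w y) :
    Γ'.Walk (φ.onV x) w (φ.onV y) := by
  induction h with
  | nil x => exact .nil _
  | cons e _ ih =>
    refine Walk.cons_iff.2 ⟨φ.onE e, φ.src_onE e, φ.lab_onE e, ?_⟩
    rwa [φ.tgt_onE]

end InvolutiveGraph

/-! ### End-cones as sets of labels of walks -/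

namespace InvolutiveGraph

variable {A : Type*} {Γ : InvolutiveGraph A} {x₀ : Γ.V}

theorem induce_walk_iff {S : Set Γ.V} {x y : (Γ.induce S).V} {w : List (Letter A)} :
    (Γ.induce S).Walk x w y ↔ Γ.WalkIn S x.1 w y.1 := by
  induction w generalizing x with
  | nil =>
    rw [Walk.nil_iff, WalkIn.nil_iff]
    exact ⟨fun h => ⟨congrArg Subtype.val h, x.2⟩, fun h => Subtype.ext h.1⟩
  | cons a w ih =>
    simp only [Walk.cons_iff, WalkIn.cons_iff, ih]
    constructor
    · rintro ⟨e, rfl, ha, h⟩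
      exact ⟨e.2.1, e.1, rfl, ha, h⟩
    · rintro ⟨hx, e, he, ha, h⟩
      exact ⟨⟨e, he ▸ hx, h.mem_left⟩, Subtype.ext he, ha, h⟩

/-- `Γ.ConeWalk x₀ b w y`: the word `w` labels a walk from `b` to `y` on which no vertex is closer
to the root `x₀` than `b`. These are the walks from `b` in the end-cone at `b`. -/
def ConeWalk (Γ : InvolutiveGraph A) (x₀ b : Γ.V) (w : List (Letter A)) (y : Γ.V) : Prop :=
  Γ.WalkIn (Γ.outside x₀ (Γ.dist x₀ b)) b w y

theorem mem_coneVerts {v y : Γ.V} : y ∈ Γ.coneVerts x₀ v ↔ ∃ w, Γ.ConeWalk x₀ v w y := by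
  constructor
  · rintro ⟨hy, w, hw⟩
    exact ⟨w, induce_walk_iff.1 hw⟩
  · rintro ⟨w, hw⟩
    exact ⟨hw.mem_right, w, induce_walk_iff.2 hw⟩

theorem endCone_deterministic (hΓ : Γ.IsInverse) (v : Γ.V) (e f : (Γ.endCone x₀ v).E)
    (hs : (Γ.endCone x₀ v).src e = (Γ.endCone x₀ v).src f)
    (hl : (Γ.endCone x₀ v).lab e = (Γ.endCone x₀ v).lab f) : e = f :=
  Subtype.ext (hΓ.deterministic _ _ (congrArg Subtype.val hs) hl)

namespace ConeWalk

variable {b y z : Γ.V} {w w' : List (Letter A)}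

theorem dist_le (h : Γ.ConeWalk x₀ b w y) : Γ.dist x₀ b ≤ Γ.dist x₀ y :=
  h.mem_right

theorem nil (b : Γ.V) : Γ.ConeWalk x₀ b [] b :=
  WalkIn.nil (le_refl (Γ.dist x₀ b))

theorem append_iff : Γ.ConeWalk x₀ b (w ++ w') y ↔
    ∃ z, Γ.ConeWalk x₀ b w z ∧ Γ.WalkIn (Γ.outside x₀ (Γ.dist x₀ b)) z w' y :=
  WalkIn.append_iff

/-- A walk in the end-cone at `b` and a walk in the end-cone at a vertex of the former compose. -/
theorem append (h : Γ.ConeWalk x₀ b w y) (h' : Γ.ConeWalk x₀ y w' z) :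
    Γ.ConeWalk x₀ b (w ++ w') z :=
  append_iff.2 ⟨y, h, WalkIn.mono (fun _ ht => le_trans h.dist_le ht) h'⟩

theorem exists_append_circuit (h : Γ.ConeWalk x₀ b w y) : ∃ q,
    Γ.WalkIn (Γ.outside x₀ (Γ.dist x₀ b)) y q b ∧ Γ.ConeWalk x₀ b (w ++ q) b :=
  ⟨invWord w, WalkIn.inverse h, append_iff.2 ⟨y, h, WalkIn.inverse h⟩⟩

theorem right_unique (hΓ : Γ.IsInverse) (h : Γ.ConeWalk x₀ b w y) (h' : Γ.ConeWalk x₀ b w z) :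
    y = z :=
  WalkIn.right_unique hΓ h h'

end ConeWalk

theorem exists_equiv_of_rel {X Y : Type*} (ρ : X → Y → Prop) (h₁ : ∀ x, ∃ y, ρ x y)
    (h₂ : ∀ y, ∃ x, ρ x y) (h₃ : ∀ x y y', ρ x y → ρ x y' → y = y')
    (h₄ : ∀ x x' y, ρ x y → ρ x' y → x = x') : ∃ f : X ≃ Y, ∀ x, ρ x (f x) := by
  choose f hf using h₁
  refine ⟨Equiv.ofBijective f ⟨fun x x' h => h₄ x x' (f x) (hf x) (h ▸ hf x'), fun y => ?_⟩, hf⟩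
  obtain ⟨x, hx⟩ := h₂ y
  exact ⟨x, h₃ x _ _ (hf x) hx⟩

/-- An end-cone is determined up to end-isomorphism by the pairs of words that label walks from its
apex to a common vertex, and by the words that lead to the frontier. -/
theorem endIsomorphic_of_words (hΓ : Γ.IsInverse) {v v' : Γ.V}
    (h₁ : ∀ w w', (∃ y, Γ.ConeWalk x₀ v w y ∧ Γ.ConeWalk x₀ v w' y) ↔
      ∃ y, Γ.ConeWalk x₀ v' w y ∧ Γ.ConeWalk x₀ v' w' y)
    (h₂ : ∀ w, (∃ y, Γ.ConeWalk x₀ v w y ∧ Γ.dist x₀ y = Γ.dist x₀ v) ↔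
      ∃ y, Γ.ConeWalk x₀ v' w y ∧ Γ.dist x₀ y = Γ.dist x₀ v') :
    Γ.EndIsomorphic x₀ v v' := by
  have hdef : ∀ w, (∃ y, Γ.ConeWalk x₀ v w y) ↔ ∃ y, Γ.ConeWalk x₀ v' w y := by
    intro w
    simpa using h₁ w w
  obtain ⟨f, hf⟩ := exists_equiv_of_rel
    (fun (y : (Γ.endCone x₀ v).V) (y' : (Γ.endCone x₀ v').V) =>
      ∃ w, Γ.ConeWalk x₀ v w y.1 ∧ Γ.ConeWalk x₀ v' w y'.1)
    (by
      intro y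
      obtain ⟨w, hw⟩ := mem_coneVerts.1 y.2
      obtain ⟨y', hy'⟩ := (hdef w).1 ⟨_, hw⟩
      exact ⟨⟨y', mem_coneVerts.2 ⟨w, hy'⟩⟩, w, hw, hy'⟩)
    (by
      intro y
      obtain ⟨w, hw⟩ := mem_coneVerts.1 y.2
      obtain ⟨y', hy'⟩ := (hdef w).2 ⟨_, hw⟩
      exact ⟨⟨y', mem_coneVerts.2 ⟨w, hy'⟩⟩, w, hy', hw⟩)
    (by
      rintro x y y' ⟨w, hx, hy⟩ ⟨w', hx', hy'⟩
      obtain ⟨t, ht, ht'⟩ := (h₁ w w').1 ⟨_, hx, hx'⟩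
      exact Subtype.ext ((hy.right_unique hΓ ht).trans (ht'.right_unique hΓ hy')))
    (by
      rintro x x' y ⟨w, hx, hy⟩ ⟨w', hx', hy'⟩
      obtain ⟨t, ht, ht'⟩ := (h₁ w w').2 ⟨_, hy, hy'⟩
      exact Subtype.ext ((hx.right_unique hΓ ht).trans (ht'.right_unique hΓ hx')))
  have hfr : ∀ y, Γ.dist x₀ y.1 = Γ.dist x₀ v ↔ Γ.dist x₀ (f y).1 = Γ.dist x₀ v' := by
    intro y
    obtain ⟨w, hw, hw'⟩ := hf y
    constructor
    · intro h
      obtain ⟨t, ht, hd⟩ := (h₂ w).1 ⟨_, hw, h⟩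
      rwa [hw'.right_unique hΓ ht]
    · intro h
      obtain ⟨t, ht, hd⟩ := (h₂ w).2 ⟨_, hw', h⟩
      rwa [hw.right_unique hΓ ht]
  have huniq : ∀ y w t, Γ.ConeWalk x₀ v w y.1 → Γ.ConeWalk x₀ v' w t → (f y).1 = t := by
    intro y w t h h'
    obtain ⟨u, hu, hu'⟩ := hf y
    obtain ⟨s, hs, hs'⟩ := (h₁ u w).1 ⟨_, hu, h⟩
    exact (hu'.right_unique hΓ hs).trans (hs'.right_unique hΓ h')
  have huniq' : ∀ y w t, Γ.ConeWalk x₀ v' w (f y).1 → Γ.ConeWalk x₀ v w t → y.1 = t := by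
    intro y w t h h'
    obtain ⟨u, hu, hu'⟩ := hf y
    obtain ⟨s, hs, hs'⟩ := (h₁ u w).2 ⟨_, hu', h⟩
    exact (hu.right_unique hΓ hs).trans (hs'.right_unique hΓ h')
  obtain ⟨φ, hφ⟩ := exists_iso_of_equiv (endCone_deterministic hΓ v)
    (endCone_deterministic hΓ v') f
    (by
      intro e
      obtain ⟨w, hw, hw'⟩ := hf ((Γ.endCone x₀ v).src e)
      have h : Γ.ConeWalk x₀ v (w ++ [Γ.lab e.1]) (Γ.tgt e.1) := by
        obtain ⟨_, ht⟩ := mem_coneVerts.1 e.2.2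
        exact ConeWalk.append_iff.2
          ⟨_, hw, WalkIn.single_iff.2 ⟨hw.mem_right, ht.mem_right, e.1, rfl, rfl, rfl⟩⟩
      obtain ⟨t, ht⟩ := (hdef _).1 ⟨_, h⟩
      obtain ⟨s, hs, hst⟩ := ConeWalk.append_iff.1 ht
      obtain ⟨_, _, e', he', hl, ht'⟩ := WalkIn.single_iff.1 hst
      have hs' := hs.right_unique hΓ hw'
      refine ⟨⟨e', ?_, ?_⟩, Subtype.ext (he'.trans hs'), hl, Subtype.ext ?_⟩
      · rw [he']
        exact mem_coneVerts.2 ⟨_, hs⟩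
      · rw [ht']
        exact mem_coneVerts.2 ⟨_, ht⟩
      · exact ht'.trans (huniq ((Γ.endCone x₀ v).tgt e) _ _ h ht).symm)
    (by
      intro e
      obtain ⟨y, hy⟩ := f.surjective ((Γ.endCone x₀ v').src e)
      obtain ⟨y₁, hy₁⟩ := f.surjective ((Γ.endCone x₀ v').tgt e)
      obtain ⟨w, hw, hw'⟩ := hf y
      rw [hy] at hw'
      have h : Γ.ConeWalk x₀ v' (w ++ [Γ.lab e.1]) (Γ.tgt e.1) := by
        obtain ⟨_, ht⟩ := mem_coneVerts.1 e.2.2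
        exact ConeWalk.append_iff.2
          ⟨_, hw', WalkIn.single_iff.2 ⟨hw'.mem_right, ht.mem_right, e.1, rfl, rfl, rfl⟩⟩
      obtain ⟨t, ht⟩ := (hdef _).2 ⟨_, h⟩
      obtain ⟨s, hs, hst⟩ := ConeWalk.append_iff.1 ht
      obtain ⟨_, _, e', he', hl, ht'⟩ := WalkIn.single_iff.1 hst
      have hs' := hs.right_unique hΓ hw
      have ht₁ : y₁.1 = t := huniq' y₁ _ _ (by rw [hy₁]; exact h) ht
      refine ⟨⟨e', ?_, ?_⟩, ?_, hl.symm, ?_⟩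
      · rw [he']
        exact mem_coneVerts.2 ⟨_, hs⟩
      · rw [ht']
        exact mem_coneVerts.2 ⟨_, ht⟩
      · rw [← hy]
        exact congrArg f (Subtype.ext (he'.trans hs').symm)
      · rw [← hy₁]
        exact congrArg f (Subtype.ext (ht'.trans ht₁.symm).symm))
  refine ⟨φ, ?_⟩
  rw [hφ]
  ext y
  constructor
  · rintro ⟨t, ht, rfl⟩
    exact (hfr t).1 ht
  · intro hy
    obtain ⟨t, rfl⟩ := f.surjective y
    exact ⟨t, (hfr t).2 hy, rfl⟩

/-- The type of a vertex `b`: which words label walks from `b` in the end-cone at `b`, which of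
these lead to the same vertex, and how far that vertex lies beyond the frontier. -/
def coneType (Γ : InvolutiveGraph A) (x₀ b : Γ.V) :
    Set (List (Letter A) × List (Letter A) × ℕ) :=
  {t | ∃ y, Γ.ConeWalk x₀ b t.1 y ∧ Γ.ConeWalk x₀ b t.2.1 y ∧
    Γ.dist x₀ y = Γ.dist x₀ b + t.2.2}

/-- A walk among the vertices that are no closer to the root than `v` stays in the end-cone at `v`
once it starts there. -/
theorem WalkIn.coneVerts {v x y : Γ.V} {w : List (Letter A)}
    (h : Γ.WalkIn (Γ.outside x₀ (Γ.dist x₀ v)) x w y) (hxv : x ∈ Γ.coneVerts x₀ v) :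
    Γ.WalkIn (Γ.coneVerts x₀ v) x w y := by
  induction h with
  | nil _ => exact .nil hxv
  | cons e hx h ih =>
    refine .cons e hxv (ih ?_)
    obtain ⟨u, hu⟩ := mem_coneVerts.1 hxv
    exact mem_coneVerts.2 ⟨u ++ [Γ.lab e], ConeWalk.append_iff.2
      ⟨_, hu, WalkIn.single_iff.2 ⟨hx, h.mem_left, e, rfl, rfl, rfl⟩⟩⟩

/-- The walks in an end-cone from a vertex `b` of its frontier are those in the end-cone at `b`. -/
theorem coneWalk_iff_endCone_walk {v : Γ.V} {b y : (Γ.endCone x₀ v).V} {w : List (Letter A)}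
    (hb : Γ.dist x₀ b.1 = Γ.dist x₀ v) :
    Γ.ConeWalk x₀ b.1 w y.1 ↔ (Γ.endCone x₀ v).Walk b w y := by
  refine Iff.trans ?_ induce_walk_iff.symm
  unfold ConeWalk
  rw [hb]
  constructor
  · exact fun h => h.coneVerts b.2
  · intro h
    refine h.mono fun z hz => ?_
    obtain ⟨u, hu⟩ := mem_coneVerts.1 hz
    exact hu.mem_right

/-- In an end-cone the distance from the root exceeds that of the frontier by the distance from the
frontier, which is intrinsic. -/
theorem dist_le_of_endIso (hΓ : Γ.IsInverse) {v v' : Γ.V}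
    (φ : Iso (Γ.endCone x₀ v) (Γ.endCone x₀ v'))
    (hφ : ∀ y, Γ.dist x₀ y.1 = Γ.dist x₀ v → Γ.dist x₀ (φ.onV y).1 = Γ.dist x₀ v')
    (y : (Γ.endCone x₀ v).V) :
    Γ.dist x₀ (φ.onV y).1 + Γ.dist x₀ v ≤ Γ.dist x₀ y.1 + Γ.dist x₀ v' := by
  obtain ⟨u, hu⟩ := mem_coneVerts.1 y.2
  obtain ⟨z, w, hz, hw, hl⟩ := exists_walkIn_of_le_dist hΓ x₀ hu.dist_le
  have hzc : z ∈ Γ.coneVerts x₀ v :=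
    mem_coneVerts.2 ⟨u ++ invWord w, ConeWalk.append_iff.2 ⟨_, hu, hw.inverse⟩⟩
  have hw' : (Γ.endCone x₀ v).Walk ⟨z, hzc⟩ w y := by
    refine (coneWalk_iff_endCone_walk hz).1 ?_
    unfold ConeWalk
    rwa [hz]
  have h := hw'.map φ
  have hz' := hφ ⟨z, hzc⟩ hz
  have h' := dist_le_dist_add_length hΓ x₀
    (WalkIn.walk ((coneWalk_iff_endCone_walk hz').2 h))
  omega

theorem coneType_subset_of_endIso (hΓ : Γ.IsInverse) {v v' : Γ.V}
    (φ : Iso (Γ.endCone x₀ v) (Γ.endCone x₀ v'))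
    (hφ : ∀ y, Γ.dist x₀ y.1 = Γ.dist x₀ v ↔ Γ.dist x₀ (φ.onV y).1 = Γ.dist x₀ v')
    (b : (Γ.endCone x₀ v).V) (hb : Γ.dist x₀ b.1 = Γ.dist x₀ v) :
    Γ.coneType x₀ b.1 ⊆ Γ.coneType x₀ (φ.onV b).1 := by
  rintro ⟨w, w', k⟩ ⟨y, hw, hw', hk⟩
  dsimp only at hw hw' hk
  have hyc : y ∈ Γ.coneVerts x₀ v := by
    obtain ⟨u, hu⟩ := mem_coneVerts.1 b.2
    exact mem_coneVerts.2 ⟨_, hu.append hw⟩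
  have hb' := (hφ b).1 hb
  refine ⟨(φ.onV ⟨y, hyc⟩).1,
    (coneWalk_iff_endCone_walk hb').2 (((coneWalk_iff_endCone_walk (y := ⟨y, hyc⟩) hb).1 hw).map φ),
    (coneWalk_iff_endCone_walk hb').2
      (((coneWalk_iff_endCone_walk (y := ⟨y, hyc⟩) hb).1 hw').map φ), ?_⟩
  have h₁ := dist_le_of_endIso hΓ φ (fun y => (hφ y).1) ⟨y, hyc⟩
  have h₂ := dist_le_of_endIso hΓ φ.symm (by
    intro z hz
    refine (hφ _).2 ?_
    simpa [Iso.symm] using hz) (φ.onV ⟨y, hyc⟩)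
  have h₃ : φ.symm.onV (φ.onV ⟨y, hyc⟩) = ⟨y, hyc⟩ := Equiv.symm_apply_apply _ _
  rw [h₃] at h₂
  dsimp only at h₁ h₂ ⊢
  omega

/-- A graph that is context-free in the sense of Muller and Schupp has finitely many types of
vertices. -/
theorem IsContextFreeGraph.finite_range_coneType [Finite A] (hΓ : Γ.IsInverse)
    (h : Γ.IsContextFreeGraph x₀) : (Set.range (Γ.coneType x₀)).Finite := by
  obtain ⟨S, hS, hiso⟩ := h
  have hfin : (⋃ v ∈ S, Γ.coneType x₀ '' {y | Γ.dist x₀ y ≤ Γ.dist x₀ v}).Finite :=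
    hS.biUnion fun v _ => (finite_setOf_dist_le hΓ x₀ _).image _
  refine hfin.subset ?_
  rintro _ ⟨v, rfl⟩
  obtain ⟨v', hv', φ, hφ⟩ := hiso v
  have hφ' : ∀ y, Γ.dist x₀ y.1 = Γ.dist x₀ v ↔ Γ.dist x₀ (φ.onV y).1 = Γ.dist x₀ v' := by
    intro y
    have : φ.onV y ∈ Γ.frontier x₀ v' ↔ y ∈ Γ.frontier x₀ v := by
      rw [← hφ]
      exact φ.onV.injective.mem_set_image
    exact this.symm
  let b : (Γ.endCone x₀ v).V := ⟨v, mem_coneVerts.2 ⟨[], .nil v⟩⟩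
  refine Set.mem_biUnion hv' ⟨(φ.onV b).1, ((hφ' b).1 rfl).le, ?_⟩
  refine Set.Subset.antisymm ?_ (coneType_subset_of_endIso hΓ φ hφ' b rfl)
  have hs := coneType_subset_of_endIso hΓ φ.symm (by
    intro y
    rw [hφ']
    simp [Iso.symm]) (φ.onV b) ((hφ' b).1 rfl)
  have hb : φ.symm.onV (φ.onV b) = b := Equiv.symm_apply_apply _ _
  rwa [hb] at hs

/-- If finitely many data determine the end-cones up to end-isomorphism, then the graph is
context-free in the sense of Muller and Schupp. -/
theorem isContextFreeGraph_of_finite {X : Type*} (d : Γ.V → X) (hd : (Set.range d).Finite)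
    (h : ∀ v v', d v = d v' → Γ.EndIsomorphic x₀ v v') : Γ.IsContextFreeGraph x₀ := by
  have := hd.to_subtype
  exact ⟨Set.range (Set.rangeSplitting d), Set.finite_range _, fun v =>
    ⟨_, ⟨⟨d v, v, rfl⟩, rfl⟩, h v _ (Set.apply_rangeSplitting d ⟨d v, v, rfl⟩).symm⟩⟩

end InvolutiveGraph

/-! ### Context-free grammars -/

namespace ContextFreeGrammar

variable {T : Type*} {g : ContextFreeGrammar T}

/-- `g.Yields σ w`: the string `σ` of symbols derives the word `w`, described by the derivation
trees instead of the rewriting steps. -/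
inductive Yields (g : ContextFreeGrammar T) : List (Symbol T g.NT) → List T → Prop
  | nil : Yields g [] []
  | terminal (t : T) {σ : List (Symbol T g.NT)} {w : List T} :
      Yields g σ w → Yields g (.terminal t :: σ) (t :: w)
  | nonterminal (r : ContextFreeRule T g.NT) (hr : r ∈ g.rules) {σ : List (Symbol T g.NT)}
      {v w : List T} : Yields g r.output v → Yields g σ w →
      Yields g (.nonterminal r.input :: σ) (v ++ w)

namespace Yields

variable {σ τ : List (Symbol T g.NT)} {v w : List T}

theorem append (h₁ : g.Yields σ v) (h₂ : g.Yields τ w) : g.Yields (σ ++ τ) (v ++ w) := by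
  induction h₁ with
  | nil => exact h₂
  | terminal t _ ih => exact .terminal t ih
  | nonterminal r hr ha _ _ ih =>
    rw [List.append_assoc]
    exact .nonterminal r hr ha ih

theorem exists_of_append {w : List T} (h : g.Yields (σ ++ τ) w) :
    ∃ u v, w = u ++ v ∧ g.Yields σ u ∧ g.Yields τ v := by
  induction σ generalizing w with
  | nil => exact ⟨[], w, rfl, .nil, h⟩
  | cons x σ ih =>
    rw [List.cons_append] at h
    cases h with
    | terminal t h =>
      obtain ⟨u, v, rfl, hu, hv⟩ := ih h
      exact ⟨t :: u, v, rfl, .terminal t hu, hv⟩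
    | nonterminal r hr ha h =>
      obtain ⟨u, v, rfl, hu, hv⟩ := ih h
      exact ⟨_ ++ u, v, (List.append_assoc ..).symm, .nonterminal r hr ha hu, hv⟩

theorem derives (h : g.Yields σ w) : g.Derives σ (w.map .terminal) := by
  induction h with
  | nil => exact .refl _
  | terminal t _ ih => exact ih.append_left [.terminal t]
  | @nonterminal r hr σ v w _ _ ih₁ ih₂ =>
    rw [List.map_append]
    have h₁ : g.Produces (.nonterminal r.input :: σ) (r.output ++ σ) := ⟨r, hr, .head σ⟩
    exact h₁.trans_derives ((ih₁.append_right σ).trans (ih₂.append_left _))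

theorem of_rewrites {r : ContextFreeRule T g.NT} (hr : r ∈ g.rules) (h : r.Rewrites σ τ)
    (hτ : g.Yields τ w) : g.Yields σ w := by
  induction h generalizing w with
  | head s =>
    obtain ⟨u, v, rfl, hu, hv⟩ := exists_of_append hτ
    exact .nonterminal r hr hu hv
  | cons x _ ih =>
    cases hτ with
    | terminal t h => exact .terminal t (ih h)
    | nonterminal r' hr' ha h => exact .nonterminal r' hr' ha (ih h)

theorem map_terminal (w : List T) : g.Yields (w.map .terminal) w := by
  induction w with
  | nil => exact .nil
  | cons t w ih => exact .terminal t ih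

end Yields

theorem derives_iff_yields {σ : List (Symbol T g.NT)} {w : List T} :
    g.Derives σ (w.map .terminal) ↔ g.Yields σ w := by
  refine ⟨fun h => ?_, Yields.derives⟩
  induction h using Relation.ReflTransGen.head_induction_on with
  | refl => exact .map_terminal w
  | head h _ ih =>
    obtain ⟨r, hr, h⟩ := h
    exact .of_rewrites hr h ih

/-- The strings that occur inside the right-hand sides of the rules, together with the empty string
and the initial symbol. -/
def forms (g : ContextFreeGrammar T) : Set (List (Symbol T g.NT)) :=
  {σ | σ = [] ∨ σ = [.nonterminal g.initial] ∨ ∃ r ∈ g.rules, σ <:+: r.output}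

theorem finite_forms (g : ContextFreeGrammar T) : g.forms.Finite := by
  have h : (⋃ r ∈ g.rules, {σ | σ <:+: r.output}).Finite :=
    g.rules.finite_toSet.biUnion fun r _ =>
      (List.finite_toSet r.output.sublists).subset fun σ hσ => List.mem_sublists.2 hσ.sublist
  refine ((h.insert [.nonterminal g.initial]).insert []).subset ?_
  rintro σ (rfl | rfl | ⟨r, hr, hσ⟩)
  · exact Or.inl rfl
  · exact Or.inr (Or.inl rfl)
  · exact Or.inr (Or.inr (Set.mem_biUnion hr hσ))

theorem singleton_mem_forms {x : Symbol T g.NT} {σ : List (Symbol T g.NT)}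
    (h : x :: σ ∈ g.forms) : [x] ∈ g.forms := by
  rcases h with h | h | ⟨r, hr, h⟩
  · cases h
  · cases h
    exact Or.inr (Or.inl rfl)
  · exact Or.inr (Or.inr ⟨r, hr, List.IsInfix.trans ⟨[], σ, rfl⟩ h⟩)

theorem tail_mem_forms {x : Symbol T g.NT} {σ : List (Symbol T g.NT)}
    (h : x :: σ ∈ g.forms) : σ ∈ g.forms := by
  rcases h with h | h | ⟨r, hr, h⟩
  · cases h
  · cases h
    exact Or.inl rfl
  · exact Or.inr (Or.inr ⟨r, hr, List.IsInfix.trans ⟨[x], [], by simp⟩ h⟩)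

/-- The language of the words that a string of symbols derives. -/
def yield (g : ContextFreeGrammar T) (σ : List (Symbol T g.NT)) : Language T :=
  {w | g.Yields σ w}

/-- The word is cut after the part that the first symbol derives. If one of the two parts is empty,
the cut is made inside the other, and absorbing the empty part keeps it valid. -/
theorem exists_binary_split {σ : List (Symbol T g.NT)} {w : List T} (hσ : σ ∈ g.forms)
    (h : g.Yields σ w) (hw : 2 ≤ w.length) :
    ∃ w₁ w₂ : List T, w₁ ≠ [] ∧ w₂ ≠ [] ∧ w = w₁ ++ w₂ ∧ ∃ σ₁ ∈ g.forms, ∃ σ₂ ∈ g.forms,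
      g.Yields σ₁ w₁ ∧ g.Yields σ₂ w₂ ∧
      ∀ u v, g.Yields σ₁ u → g.Yields σ₂ v → g.Yields σ (u ++ v) := by
  induction h with
  | nil => simp at hw
  | @terminal t σ w h ih =>
    refine ⟨[t], w, by simp, ?_, rfl, _, singleton_mem_forms hσ, _, tail_mem_forms hσ,
      .terminal t .nil, h, fun u v hu hv => hu.append hv⟩
    rintro rfl
    simp at hw
  | @nonterminal r hr σ v w h₁ h₂ ih₁ ih₂ =>
    by_cases hv : v = []
    · subst hv
      obtain ⟨w₁, w₂, n₁, n₂, rfl, σ₁, m₁, σ₂, m₂, y₁, y₂, hy⟩ :=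
        ih₂ (tail_mem_forms hσ) (by simpa using hw)
      exact ⟨w₁, w₂, n₁, n₂, rfl, σ₁, m₁, σ₂, m₂, y₁, y₂,
        fun u v hu hv => by simpa using Yields.nonterminal r hr h₁ (hy u v hu hv)⟩
    by_cases hw' : w = []
    · subst hw'
      obtain ⟨w₁, w₂, n₁, n₂, rfl, σ₁, m₁, σ₂, m₂, y₁, y₂, hy⟩ :=
        ih₁ (Or.inr (Or.inr ⟨r, hr, List.infix_rfl⟩)) (by simpa using hw)
      refine ⟨w₁, w₂, n₁, n₂, by simp, σ₁, m₁, σ₂, m₂, y₁, y₂, fun u v hu hv => ?_⟩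
      simpa using Yields.nonterminal r hr (hy u v hu hv) h₂
    · refine ⟨v, w, hv, hw', rfl, _, singleton_mem_forms hσ, _, tail_mem_forms hσ, ?_, h₂,
        fun u v hu hv => hu.append hv⟩
      simpa using Yields.nonterminal r hr h₁ .nil

end ContextFreeGrammar

/-- A family of languages in which every word of length at least two splits into two shorter words,
each of which may be replaced by the words of a member of the family. -/
def SplitFamily {T : Type*} (𝓛 : Set (Language T)) : Prop :=
  ∀ P ∈ 𝓛, ∀ w ∈ P, 2 ≤ w.length → ∃ w₁ w₂ : List T, w₁ ≠ [] ∧ w₂ ≠ [] ∧ w = w₁ ++ w₂ ∧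
    ∃ Q ∈ 𝓛, ∃ R ∈ 𝓛, w₁ ∈ Q ∧ w₂ ∈ R ∧ ∀ u ∈ Q, ∀ v ∈ R, u ++ v ∈ P

/-- A context-free language belongs to a finite family of languages that splits. This takes the
place of Chomsky's normal form. -/
theorem Language.IsContextFree.exists_splitFamily {T : Type*} {L : Language T}
    (hL : L.IsContextFree) : ∃ 𝓛 : Set (Language T), 𝓛.Finite ∧ L ∈ 𝓛 ∧ SplitFamily 𝓛 := by
  obtain ⟨g, rfl⟩ := hL
  refine ⟨g.yield '' g.forms, g.finite_forms.image _, ⟨_, Or.inr (Or.inl rfl), ?_⟩, ?_⟩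
  · ext w
    exact ContextFreeGrammar.derives_iff_yields.symm
  · rintro _ ⟨σ, hσ, rfl⟩ w hw hlen
    obtain ⟨w₁, w₂, n₁, n₂, rfl, σ₁, m₁, σ₂, m₂, y₁, y₂, hy⟩ :=
      ContextFreeGrammar.exists_binary_split hσ hw hlen
    exact ⟨w₁, w₂, n₁, n₂, rfl, _, ⟨σ₁, m₁, rfl⟩, _, ⟨σ₂, m₂, rfl⟩, y₁, y₂,
      fun u hu v hv => hy u v hu hv⟩

/-- `SymbolsMatch sem σ w`: the word `w` is a product of words that match the symbols of `σ`, where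
a terminal matches itself and a nonterminal `n` matches the words of `sem n`. -/
def SymbolsMatch {T N : Type*} (sem : N → Language T) : List (Symbol T N) → List T → Prop
  | [], w => w = []
  | .terminal t :: σ, w => ∃ v, w = t :: v ∧ SymbolsMatch sem σ v
  | .nonterminal n :: σ, w => ∃ u v, w = u ++ v ∧ u ∈ sem n ∧ SymbolsMatch sem σ v

theorem symbolsMatch_of_yields {T : Type*} {g : ContextFreeGrammar T} {sem : g.NT → Language T}
    (hg : ∀ r ∈ g.rules, ∀ w, SymbolsMatch sem r.output w → w ∈ sem r.input)
    {σ : List (Symbol T g.NT)} {w : List T} (h : g.Yields σ w) : SymbolsMatch sem σ w := by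
  induction h with
  | nil => exact rfl
  | terminal t _ ih => exact ⟨_, rfl, ih⟩
  | nonterminal r hr _ _ ih₁ ih₂ => exact ⟨_, _, rfl, hg r hr _ ih₁, ih₂⟩

/-- The grammar of all rules with at most two symbols on the right-hand side that are valid for an
intended meaning `sem` of the nonterminals. -/
noncomputable def soundGrammar {T : Type*} [Finite T] {N : Type} [Finite N] (sem : N → Language T)
    (start : N) : ContextFreeGrammar T where
  NT := N
  initial := start
  rules := Set.Finite.toFinset
    (s := {r : ContextFreeRule T N |
      r.output.length ≤ 2 ∧ ∀ w, SymbolsMatch sem r.output w → w ∈ sem r.input}) <| by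
    have : Finite (Symbol T N) :=
      Finite.of_injective (β := T ⊕ N)
          (fun | .terminal t => .inl t | .nonterminal n => .inr n) <| by
        rintro (t | n) (t' | n') h <;> simp_all
    refine Set.Finite.subset
      (((Set.finite_univ (α := N)).prod (List.finite_length_le (Symbol T N) 2)).image
        fun p => ContextFreeRule.mk p.1 p.2) ?_
    rintro r ⟨hr, _⟩
    exact ⟨(r.input, r.output), ⟨trivial, hr⟩, rfl⟩

section SoundGrammar

variable {T : Type*} [Finite T] {N : Type} [Finite N] {sem : N → Language T} {start : N}

theorem mem_rules_soundGrammar {r : ContextFreeRule T N} :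
    r ∈ (soundGrammar sem start).rules ↔
      r.output.length ≤ 2 ∧ ∀ w, SymbolsMatch sem r.output w → w ∈ sem r.input := by
  exact Set.Finite.mem_toFinset _

/-- A word that matches the right-hand side of a valid rule through derivable words is derivable
from the left-hand side. -/
theorem yields_of_symbolsMatch {σ : List (Symbol T N)} {n : N} {w : List T} (hlen : σ.length ≤ 2)
    (hsound : ∀ w, SymbolsMatch sem σ w → w ∈ sem n)
    (h : (soundGrammar sem start).Yields σ w) :
    (soundGrammar sem start).Yields [.nonterminal n] w := by
  have := ContextFreeGrammar.Yields.nonterminal (g := soundGrammar sem start) ⟨n, σ⟩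
    (mem_rules_soundGrammar.2 ⟨hlen, hsound⟩) h .nil
  rwa [List.append_nil] at this

theorem language_soundGrammar
    (h : ∀ w ∈ sem start, (soundGrammar sem start).Yields [.nonterminal start] w) :
    (soundGrammar sem start).language = sem start := by
  ext w
  refine ContextFreeGrammar.derives_iff_yields.trans ⟨fun hw => ?_, h w⟩
  obtain ⟨u, v, rfl, hu, hv⟩ := symbolsMatch_of_yields
    (fun r hr => (mem_rules_soundGrammar.1 hr).2) hw
  obtain rfl : v = [] := hv
  rwa [List.append_nil]

end SoundGrammar

/-! ### Triangulating circuits -/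

namespace InvolutiveGraph

variable {A : Type*} {Γ : InvolutiveGraph A} {x₀ : Γ.V}

/-- `Γ.Joins x P y`: all words of the language `P` label walks from `x` to `y`. -/
def Joins (Γ : InvolutiveGraph A) (x : Γ.V) (P : Language (Letter A)) (y : Γ.V) : Prop :=
  ∀ w ∈ P, Γ.Walk x w y

theorem Joins.split (hΓ : Γ.IsInverse) {x y : Γ.V} {P Q R : Language (Letter A)}
    (h : Γ.Joins x P y) (hQR : ∀ u ∈ Q, ∀ v ∈ R, u ++ v ∈ P) {u v : List (Letter A)}
    (hu : u ∈ Q) (hv : v ∈ R) : ∃ m, Γ.Joins x Q m ∧ Γ.Joins m R y := by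
  obtain ⟨m, h₁, h₂⟩ := Walk.append_iff.1 (h _ (hQR u hu v hv))
  exact ⟨m, fun w hw => (h _ (hQR w hw v hv)).of_append_right hΓ h₂,
    fun w hw => (h _ (hQR u hu w hw)).of_append_left hΓ h₁⟩

/-- `Γ.Chain 𝓛 G x w y`: the word `w` is a product of words of languages of `𝓛` that join
consecutive vertices of a sequence from `x` to `y`, whose vertices after `x` satisfy `G`. -/
inductive Chain (Γ : InvolutiveGraph A) (𝓛 : Set (Language (Letter A))) (G : Γ.V → Prop) :
    Γ.V → List (Letter A) → Γ.V → Prop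
  | nil (x : Γ.V) : Chain Γ 𝓛 G x [] x
  | cons {x y z : Γ.V} {u w : List (Letter A)} {P : Language (Letter A)} :
      P ∈ 𝓛 → Γ.Joins x P z → u ∈ P → G z → Chain Γ 𝓛 G z w y → Chain Γ 𝓛 G x (u ++ w) y

section Chain

variable {𝓛 : Set (Language (Letter A))} {G G' : Γ.V → Prop} {x y z : Γ.V}
  {v w : List (Letter A)}

theorem Chain.append (h₁ : Γ.Chain 𝓛 G x v y) (h₂ : Γ.Chain 𝓛 G y w z) :
    Γ.Chain 𝓛 G x (v ++ w) z := by
  induction h₁ with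
  | nil _ => exact h₂
  | cons hP hj hu hG _ ih =>
    rw [List.append_assoc]
    exact .cons hP hj hu hG (ih h₂)

theorem Chain.mono (hG : ∀ z, G z → G' z) (h : Γ.Chain 𝓛 G x w y) : Γ.Chain 𝓛 G' x w y := by
  induction h with
  | nil _ => exact .nil _
  | cons hP hj hu hz _ ih => exact .cons hP hj hu (hG _ hz) ih

/-- Let the sides `u`, `p` and `s` of a polygon be closed by a language of `𝓛` that contains
`u ++ p ++ s`. Then the side `p` is a chain, each interior vertex of which is joined by a language
of `𝓛` to a vertex of `u` or of `s`: these are the chords of a triangulation of the polygon that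
leave the side `p`. -/
theorem exists_chain (hΓ : Γ.IsInverse) (h𝓛 : SplitFamily 𝓛) {P : Language (Letter A)}
    (hP : P ∈ 𝓛) {x y v c : Γ.V} (hj : Γ.Joins x P y) {u p s : List (Letter A)}
    (hw : u ++ (p ++ s) ∈ P) {U Z W : Set Γ.V} (hu : Γ.WalkIn U x u v) (hp : Γ.WalkIn Z v p c)
    (hs : Γ.WalkIn W c s y)
    (h₁ : u ≠ [] → ∀ t ∈ U, ∀ z ∈ Z, ∀ P ∈ 𝓛, (∃ q, q ∈ P) → Γ.Joins t P z → G z)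
    (h₂ : s ≠ [] → ∀ t ∈ W, ∀ z ∈ Z, ∀ P ∈ 𝓛, (∃ q, q ∈ P) → Γ.Joins z P t → G z)
    (h₃ : G c) : Γ.Chain 𝓛 G v p c := by
  induction hn : (u ++ (p ++ s)).length using Nat.strong_induction_on
    generalizing P x y v c u p s U W with
  | _ n ih =>
  subst hn
  by_cases hp₀ : p = []
  · subst hp₀
    obtain ⟨rfl, _⟩ := WalkIn.nil_iff.1 hp
    exact .nil _
  by_cases hus : u = [] ∧ s = []
  · obtain ⟨rfl, rfl⟩ := hus
    obtain ⟨rfl, _⟩ := WalkIn.nil_iff.1 hu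
    obtain ⟨rfl, _⟩ := WalkIn.nil_iff.1 hs
    rw [List.nil_append] at hw
    have := Chain.cons (G := G) hP hj hw h₃ (.nil _)
    rwa [List.append_nil, List.append_nil] at this
  have hlen : 2 ≤ (u ++ (p ++ s)).length := by
    have := List.length_pos_iff.2 hp₀
    rw [not_and_or] at hus
    simp only [List.length_append]
    rcases hus with h | h <;> have := List.length_pos_iff.2 h <;> omega
  obtain ⟨w₁, w₂, n₁, n₂, hsplit, Q, hQ, R, hR, hw₁, hw₂, hQR⟩ := h𝓛 P hP _ hw hlen
  have n₁' := List.length_pos_iff.2 n₁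
  have n₂' := List.length_pos_iff.2 n₂
  obtain ⟨m, hm₁, hm₂⟩ := hj.split hΓ hQR hw₁ hw₂
  rcases List.append_eq_append_iff.1 hsplit with ⟨a, rfl, ha⟩ | ⟨b, rfl, rfl⟩
  · rcases List.append_eq_append_iff.1 ha with ⟨d, rfl, rfl⟩ | ⟨d, rfl, rfl⟩
    · -- the cut lies on the side `s`
      obtain ⟨t, hd, _⟩ := WalkIn.append_iff.1 hs
      obtain rfl : t = m := ((hu.walk.append hp.walk).append hd.walk).right_unique hΓ
        (by simpa using hm₁ _ hw₁)
      refine ih _ ?_ hQ hm₁ hw₁ hu hp hd h₁ (fun hd₀ => h₂ ?_) h₃ rfl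
      · simp only [List.length_append] at n₂' ⊢
        omega
      · simp [hd₀]
    · -- the cut lies on the side `p`
      obtain ⟨t, ha, hd⟩ := WalkIn.append_iff.1 hp
      obtain rfl : t = m := (hu.walk.append ha.walk).right_unique hΓ (hm₁ _ hw₁)
      have hGt : G t := by
        rw [not_and_or] at hus
        rcases hus with h | h
        · exact h₁ h x hu.mem_left t ha.mem_right Q hQ ⟨_, hw₁⟩ hm₁
        · exact h₂ h y hs.mem_right t ha.mem_right R hR ⟨_, hw₂⟩ hm₂
      refine Chain.append
        (ih (u ++ (a ++ [])).length ?_ hQ hm₁ (by simpa using hw₁) hu ha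
          (WalkIn.nil (Set.mem_univ t)) h₁ (fun h => absurd rfl h) hGt rfl)
        (ih ([] ++ (d ++ s)).length ?_ hR hm₂ (by simpa using hw₂)
          (WalkIn.nil (Set.mem_univ t)) hd hs (fun h => absurd rfl h) h₂ h₃ rfl)
      · simp only [List.length_append, List.length_nil] at n₂' ⊢
        omega
      · simp only [List.length_append, List.length_nil] at n₁' ⊢
        omega
  · -- the cut lies on the side `u`
    obtain ⟨t, hu₁, hu₂⟩ := WalkIn.append_iff.1 hu
    obtain rfl : t = m := hu₁.walk.right_unique hΓ (hm₁ _ hw₁)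
    refine ih _ ?_ hR hm₂ hw₂ hu₂ hp hs (fun _ => h₁ ?_) h₂ h₃ rfl
    · simp only [List.length_append] at n₁' ⊢
      omega
    · simp [n₁]

/-- If every vertex of a chain from `v` to `c` is close to `v` or to `c`, then `v` is close
to `c`. -/
theorem Chain.exists_walk_length_le {K N : ℕ}
    (hK : ∀ P ∈ 𝓛, (∃ q, q ∈ P) → ∃ q ∈ P, q.length ≤ K) {v c : Γ.V} {p : List (Letter A)}
    (h : Γ.Chain 𝓛 (fun z => (∃ h, Γ.Walk v h z ∧ h.length ≤ N) ∨
      ∃ h, Γ.Walk c h z ∧ h.length ≤ N) x p c)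
    (hx : ∃ h, Γ.Walk v h x ∧ h.length ≤ N) : ∃ h, Γ.Walk v h c ∧ h.length ≤ N + K + N := by
  generalize hG : (fun z => (∃ h, Γ.Walk v h z ∧ h.length ≤ N) ∨
    ∃ h, Γ.Walk c h z ∧ h.length ≤ N) = G at h
  induction h with
  | nil x =>
    obtain ⟨h, hh, hl⟩ := hx
    exact ⟨h, hh, by omega⟩
  | cons hP hj hu hz _ ih =>
    subst hG
    rcases hz with hz | ⟨k, hk, hkl⟩
    · exact ih hz rfl
    · obtain ⟨h, hh, hl⟩ := hx
      obtain ⟨q, hq, hql⟩ := hK _ hP ⟨_, hu⟩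
      refine ⟨h ++ q ++ invWord k, (hh.append (hj q hq)).append hk.inverse, ?_⟩
      simp only [List.length_append, length_invWord]
      omega

end Chain

/-- A vertex on a walk from `x` to `v` is at most as far from `v` as the length of the walk and the
distances from the root allow. -/
theorem Walk.walkIn_setOf_le (hΓ : Γ.IsInverse) {x v : Γ.V} {w : List (Letter A)}
    (hw : Γ.Walk x w v) :
    Γ.WalkIn {t | ∃ h, Γ.Walk v h t ∧ h.length + Γ.dist x₀ t ≤ Γ.dist x₀ x + w.length} x w v := by
  induction hw with
  | nil x => exact .nil ⟨[], .nil x, by simp⟩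
  | @cons e w v hw ih =>
    have hew := (Walk.edge e).append hw
    refine .cons e ⟨invWord (Γ.lab e :: w), hew.inverse, by simp; omega⟩ (ih.mono ?_)
    rintro t ⟨h, hh, hl⟩
    have := dist_le_dist_add_length hΓ x₀ (Walk.edge e)
    exact ⟨h, hh, by simp at this ⊢; omega⟩

/-- If the circuits at some vertex form a context-free language, then a walk in an end-cone between
vertices of its frontier is a chain of languages of a finite family in a ball of fixed radius.
The root of the end-cones need not be the base point of the circuits. -/
theorem exists_chain_of_isContextFree (hΓ : Γ.IsInverse) {o : Γ.V}
    (hL : (Γ.lang o).IsContextFree) (x₀ : Γ.V) :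
    ∃ (𝓛 : Set (Language (Letter A))) (R : ℕ), 𝓛.Finite ∧ ∀ v p c, Γ.ConeWalk x₀ v p c →
      Γ.dist x₀ c = Γ.dist x₀ v →
      Γ.Chain 𝓛 (fun z => ∃ h, Γ.Walk v h z ∧ h.length ≤ R) v p c := by
  obtain ⟨𝓛, hfin, hL, h𝓛⟩ := hL.exists_splitFamily
  obtain ⟨K, hK⟩ : ∃ K, ∀ P ∈ 𝓛, (∃ q, q ∈ P) → ∃ q ∈ P, q.length ≤ K := by
    choose! f hf using fun (P : Language (Letter A)) (h : ∃ q, q ∈ P) => h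
    obtain ⟨K, hK⟩ := (hfin.image fun P => (f P).length).bddAbove
    exact ⟨K, fun P hP hq => ⟨f P, hf P hq, hK ⟨P, hP, rfl⟩⟩⟩
  obtain ⟨g, hg⟩ := hΓ.connected o x₀
  have ho := dist_le_dist_add_length hΓ x₀ hg.inverse
  rw [dist_self, length_invWord, Nat.zero_add] at ho
  -- walks from `o` through the root whose vertices cannot be far from the end without being close
  -- to the root
  have hside : ∀ v, ∃ u, Γ.WalkIn {t | ∃ h, Γ.Walk v h t ∧
      h.length + Γ.dist x₀ t ≤ Γ.dist x₀ v + 2 * g.length} o u v := by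
    intro v
    obtain ⟨w, hw, hl⟩ := exists_walk_length_eq_dist hΓ x₀ v
    refine ⟨g ++ w, ((hg.append hw).walkIn_setOf_le (x₀ := x₀) hΓ).mono ?_⟩
    rintro t ⟨h, hh, ht⟩
    exact ⟨h, hh, by simp only [List.length_append] at ht; omega⟩
  -- twice the length of a chord and twice the distance of the two base points
  let N := 2 * K + 2 * g.length
  refine ⟨𝓛, N + K + N + N, hfin, fun v p c hp hc => ?_⟩
  obtain ⟨u, hu⟩ := hside v
  obtain ⟨s, hs⟩ := hside c
  have hchain : Γ.Chain 𝓛 (fun z => (∃ h, Γ.Walk v h z ∧ h.length ≤ N) ∨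
      ∃ h, Γ.Walk c h z ∧ h.length ≤ N) v p c := by
    refine exists_chain hΓ h𝓛 hL (fun w hw => hw)
      (hu.walk.append (WalkIn.walk hp |>.append hs.inverse.walk)) hu hp hs.inverse
      (fun _ t ht z hz P hP hPn hj => Or.inl ?_) (fun _ t ht z hz P hP hPn hj => Or.inr ?_)
      (Or.inr ⟨[], .nil c, Nat.zero_le _⟩)
    · obtain ⟨q, hq, hql⟩ := hK P hP hPn
      obtain ⟨h, hh, hl⟩ := ht
      have hqw := hj q hq
      have := dist_le_dist_add_length hΓ x₀ hqw
      have hz' : Γ.dist x₀ v ≤ Γ.dist x₀ z := hz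
      refine ⟨h ++ q, hh.append hqw, ?_⟩
      simp only [List.length_append, N]
      omega
    · obtain ⟨q, hq, hql⟩ := hK P hP hPn
      obtain ⟨h, hh, hl⟩ := ht
      have hqw := hj q hq
      have := dist_le_dist_add_length' hΓ x₀ hqw
      have hz' : Γ.dist x₀ v ≤ Γ.dist x₀ z := hz
      refine ⟨h ++ invWord q, hh.append hqw.inverse, ?_⟩
      simp only [List.length_append, length_invWord, N]
      omega
  obtain ⟨k, hk, hkl⟩ := hchain.exists_walk_length_le hK ⟨[], .nil v, Nat.zero_le _⟩
  refine hchain.mono ?_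
  rintro z (⟨h, hh, hl⟩ | ⟨h, hh, hl⟩)
  · exact ⟨h, hh, by omega⟩
  · exact ⟨k ++ h, hk.append hh, by simp only [List.length_append]; omega⟩

/-! ### End-cones are determined by balls -/

/-- The information on the ball of radius `R` at `v` that determines the end-cone at `v`: which
words lead from `v` to the same vertex, which lead no closer to the root, which stay at the same
distance from the root, and which languages of `𝓛` join the vertices of the ball. -/
def ballData (Γ : InvolutiveGraph A) (x₀ : Γ.V) (𝓛 : Set (Language (Letter A))) (R : ℕ)
    (v : Γ.V) :
    Set ({h : List (Letter A) // h.length ≤ R} × {h : List (Letter A) // h.length ≤ R}) ×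
      Set {h : List (Letter A) // h.length ≤ R} × Set {h : List (Letter A) // h.length ≤ R} ×
      Set ({P // P ∈ 𝓛} × {h : List (Letter A) // h.length ≤ R} ×
        {h : List (Letter A) // h.length ≤ R}) :=
  ({t | ∃ y, Γ.Walk v t.1.1 y ∧ Γ.Walk v t.2.1 y},
    {h | ∃ y, Γ.Walk v h.1 y ∧ Γ.dist x₀ v ≤ Γ.dist x₀ y},
    {h | ∃ y, Γ.Walk v h.1 y ∧ Γ.dist x₀ y = Γ.dist x₀ v},
    {t | ∃ y z, Γ.Walk v t.2.1.1 y ∧ Γ.Walk v t.2.2.1 z ∧ Γ.Joins y t.1.1 z})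

theorem finite_range_ballData [Finite A] {𝓛 : Set (Language (Letter A))} (h𝓛 : 𝓛.Finite) (R : ℕ) :
    (Set.range (Γ.ballData x₀ 𝓛 R)).Finite := by
  have := h𝓛.to_subtype
  have : Finite {h : List (Letter A) // h.length ≤ R} := List.finite_length_le _ R
  exact Set.toFinite _

section BallData

variable {𝓛 : Set (Language (Letter A))} {R : ℕ} {v v' : Γ.V}

theorem exists_walk_of_ballData_eq (h : Γ.ballData x₀ 𝓛 R v = Γ.ballData x₀ 𝓛 R v')
    {w w' : List (Letter A)} (hw : w.length ≤ R) (hw' : w'.length ≤ R) {y : Γ.V}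
    (h₁ : Γ.Walk v w y) (h₂ : Γ.Walk v w' y) : ∃ y', Γ.Walk v' w y' ∧ Γ.Walk v' w' y' := by
  have hs := congrArg (fun d => d.1) h
  exact (Set.ext_iff.1 hs (⟨w, hw⟩, ⟨w', hw'⟩)).1 ⟨y, h₁, h₂⟩

theorem dist_le_of_ballData_eq (hΓ : Γ.IsInverse)
    (h : Γ.ballData x₀ 𝓛 R v = Γ.ballData x₀ 𝓛 R v') {w : List (Letter A)} (hw : w.length ≤ R)
    {y y' : Γ.V} (h₁ : Γ.Walk v w y) (h₂ : Γ.Walk v' w y') (hy : Γ.dist x₀ v ≤ Γ.dist x₀ y) :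
    Γ.dist x₀ v' ≤ Γ.dist x₀ y' := by
  have hs := congrArg (fun d => d.2.1) h
  obtain ⟨z, hz, hd⟩ := (Set.ext_iff.1 hs ⟨w, hw⟩).1 ⟨y, h₁, hy⟩
  rwa [h₂.right_unique hΓ hz]

theorem dist_eq_of_ballData_eq (hΓ : Γ.IsInverse)
    (h : Γ.ballData x₀ 𝓛 R v = Γ.ballData x₀ 𝓛 R v') {w : List (Letter A)} (hw : w.length ≤ R)
    {y y' : Γ.V} (h₁ : Γ.Walk v w y) (h₂ : Γ.Walk v' w y') (hy : Γ.dist x₀ y = Γ.dist x₀ v) :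
    Γ.dist x₀ y' = Γ.dist x₀ v' := by
  have hs := congrArg (fun d => d.2.2.1) h
  obtain ⟨z, hz, hd⟩ := (Set.ext_iff.1 hs ⟨w, hw⟩).1 ⟨y, h₁, hy⟩
  rwa [h₂.right_unique hΓ hz]

theorem joins_of_ballData_eq (hΓ : Γ.IsInverse)
    (h : Γ.ballData x₀ 𝓛 R v = Γ.ballData x₀ 𝓛 R v') {w w' : List (Letter A)} (hw : w.length ≤ R)
    (hw' : w'.length ≤ R) {x y x' : Γ.V} (h₁ : Γ.Walk v w x) (h₂ : Γ.Walk v w' y)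
    (h₃ : Γ.Walk v' w x') {P : Language (Letter A)} (hP : P ∈ 𝓛) (hj : Γ.Joins x P y) :
    ∃ y', Γ.Walk v' w' y' ∧ Γ.Joins x' P y' := by
  have hs := congrArg (fun d => d.2.2.2) h
  obtain ⟨a, b, ha, hb, hab⟩ := (Set.ext_iff.1 hs (⟨P, hP⟩, ⟨w, hw⟩, ⟨w', hw'⟩)).1
    ⟨x, y, h₁, h₂, hj⟩
  exact ⟨b, hb, by rwa [h₃.right_unique hΓ ha]⟩

/-- A chain in the ball at `v` can be followed in the ball at a vertex with the same data. -/
theorem Chain.transfer (hΓ : Γ.IsInverse) {r : ℕ} (hr : r ≤ R)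
    (h : Γ.ballData x₀ 𝓛 R v = Γ.ballData x₀ 𝓛 R v') {x y x' : Γ.V} {p : List (Letter A)}
    (hc : Γ.Chain 𝓛 (fun z => ∃ h, Γ.Walk v h z ∧ h.length ≤ r) x p y) {k : List (Letter A)}
    (hk : k.length ≤ r) (hkx : Γ.Walk v k x) (hkx' : Γ.Walk v' k x') :
    ∃ (l : List (Letter A)) (y' : Γ.V),
      l.length ≤ r ∧ Γ.Walk v l y ∧ Γ.Walk v' l y' ∧ Γ.Walk x' p y' := by
  induction hc generalizing x' k with
  | nil x => exact ⟨k, x', hk, hkx, hkx', .nil x'⟩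
  | cons hP hj hu hG _ ih =>
    obtain ⟨l, hl, hlr⟩ := hG
    obtain ⟨z, hz, hjz⟩ := joins_of_ballData_eq hΓ h (hk.trans hr) (hlr.trans hr) hkx hl hkx' hP hj
    obtain ⟨l', y', h₁, h₂, h₃, h₄⟩ := ih hlr hl hz
    exact ⟨l', y', h₁, h₂, h₃, (hjz _ hu).append h₄⟩

/-- If walks in end-cones between vertices of the frontier are chains in balls of radius `r`, then
the data of the balls of radius `r + 1` determine which words label walks in an end-cone. The
additional unit of the radius shows whether an edge from the frontier leaves the end-cone. -/
theorem ConeWalk.transfer (hΓ : Γ.IsInverse) {r : ℕ}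
    (hchain : ∀ v p c, Γ.ConeWalk x₀ v p c → Γ.dist x₀ c = Γ.dist x₀ v →
      Γ.Chain 𝓛 (fun z => ∃ h, Γ.Walk v h z ∧ h.length ≤ r) v p c)
    (h : Γ.ballData x₀ 𝓛 (r + 1) v = Γ.ballData x₀ 𝓛 (r + 1) v') {w : List (Letter A)} {y : Γ.V}
    (hw : Γ.ConeWalk x₀ v w y) : ∃ y', Γ.ConeWalk x₀ v' w y' := by
  induction w using List.reverseRecOn generalizing y with
  | nil => exact ⟨v', .nil v'⟩
  | append_singleton w a ih =>
    obtain ⟨q, _, hq⟩ := hw.exists_append_circuit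
    obtain ⟨z, hz, hzy⟩ := ConeWalk.append_iff.1 hw
    obtain ⟨z', hz'⟩ := ih hz
    obtain ⟨_, t, _, _, _, ht⟩ :=
      (hchain _ _ _ hq rfl).transfer hΓ r.le_succ h (k := []) (Nat.zero_le r) (.nil v) (.nil v')
    obtain ⟨y', hy', _⟩ := Walk.append_iff.1 ht
    have hzy' : Γ.Walk z' [a] y' := hy'.of_append_left hΓ (WalkIn.walk hz')
    obtain ⟨e, he⟩ := Walk.single_iff.1 hzy'
    refine ⟨y', ConeWalk.append_iff.2 ⟨z', hz', WalkIn.single_iff.2 ⟨hz'.mem_right, ?_, e, he⟩⟩⟩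
    have hd := dist_le_dist_add_length' hΓ x₀ hzy'
    have hd' : Γ.dist x₀ v' ≤ Γ.dist x₀ z' := hz'.dist_le
    rcases hd'.lt_or_eq with hlt | heq
    · simp only [List.length_singleton] at hd
      show Γ.dist x₀ v' ≤ Γ.dist x₀ y'
      omega
    · -- the previous vertex lies on the frontier, hence in the ball of radius `r`
      obtain ⟨l, s, hl, hlz', hls, hws⟩ := (hchain _ _ _ hz' heq.symm).transfer hΓ r.le_succ h.symm
        (k := []) (Nat.zero_le r) (.nil v') (.nil v)
      obtain rfl := hws.right_unique hΓ (WalkIn.walk hz)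
      exact dist_le_of_ballData_eq hΓ h (w := l ++ [a]) (by simpa using hl)
        (hls.append hzy.walk) (hlz'.append hzy') hzy.mem_right

/-- Under the same hypothesis, the data of balls determine the end-cones up to end-isomorphism. -/
theorem endIsomorphic_of_ballData_eq (hΓ : Γ.IsInverse) {r : ℕ}
    (hchain : ∀ v p c, Γ.ConeWalk x₀ v p c → Γ.dist x₀ c = Γ.dist x₀ v →
      Γ.Chain 𝓛 (fun z => ∃ h, Γ.Walk v h z ∧ h.length ≤ r) v p c)
    (h : Γ.ballData x₀ 𝓛 (r + 1) v = Γ.ballData x₀ 𝓛 (r + 1) v') : Γ.EndIsomorphic x₀ v v' := by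
  have key₁ : ∀ v v', Γ.ballData x₀ 𝓛 (r + 1) v = Γ.ballData x₀ 𝓛 (r + 1) v' → ∀ w w',
      (∃ y, Γ.ConeWalk x₀ v w y ∧ Γ.ConeWalk x₀ v w' y) →
      ∃ y, Γ.ConeWalk x₀ v' w y ∧ Γ.ConeWalk x₀ v' w' y := by
    rintro v v' h w w' ⟨y, hw, hw'⟩
    obtain ⟨t, ht⟩ := hw.transfer hΓ hchain h
    obtain ⟨t', ht'⟩ := hw'.transfer hΓ hchain h
    obtain ⟨q, hq, _⟩ := hw.exists_append_circuit
    -- both walks are closed by the same word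
    have hclose : ∀ u s, Γ.ConeWalk x₀ v u y → Γ.ConeWalk x₀ v' u s → Γ.Walk s q v' := by
      intro u s hu hs
      obtain ⟨l, z, hl, hlv, hlz, hz⟩ :=
        (hchain _ _ _ (ConeWalk.append_iff.2 ⟨y, hu, hq⟩) rfl).transfer hΓ r.le_succ h
          (k := []) (Nat.zero_le r) (.nil v) (.nil v')
      obtain ⟨z', h₁, h₂⟩ := exists_walk_of_ballData_eq h (hl.trans r.le_succ)
        (w' := []) (Nat.zero_le _) hlv (.nil v)
      obtain rfl := Walk.nil_iff.1 h₂
      obtain rfl := hlz.right_unique hΓ h₁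
      exact hz.of_append_left hΓ (WalkIn.walk hs)
    obtain rfl := (hclose _ _ hw ht).left_unique hΓ (hclose _ _ hw' ht')
    exact ⟨t, ht, ht'⟩
  have key₂ : ∀ v v', Γ.ballData x₀ 𝓛 (r + 1) v = Γ.ballData x₀ 𝓛 (r + 1) v' → ∀ w,
      (∃ y, Γ.ConeWalk x₀ v w y ∧ Γ.dist x₀ y = Γ.dist x₀ v) →
      ∃ y, Γ.ConeWalk x₀ v' w y ∧ Γ.dist x₀ y = Γ.dist x₀ v' := by
    rintro v v' h w ⟨y, hw, hy⟩
    obtain ⟨t, ht⟩ := hw.transfer hΓ hchain h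
    obtain ⟨l, s, hl, hly, hls, hs⟩ := (hchain _ _ _ hw hy).transfer hΓ r.le_succ h
      (k := []) (Nat.zero_le r) (.nil v) (.nil v')
    obtain rfl := hs.right_unique hΓ (WalkIn.walk ht)
    exact ⟨s, ht, dist_eq_of_ballData_eq hΓ h (hl.trans r.le_succ) hly hls hy⟩
  exact endIsomorphic_of_words hΓ (fun w w' => ⟨key₁ v v' h w w', key₁ v' v h.symm w w'⟩)
    (fun w => ⟨key₂ v v' h w, key₂ v' v h.symm w⟩)

end BallData

/-- If the circuits at some vertex form a context-free language, then the graph is context-free in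
the sense of Muller and Schupp with respect to every root. -/
theorem isContextFreeGraph_of_isContextFree [Finite A] (hΓ : Γ.IsInverse) {o : Γ.V}
    (hL : (Γ.lang o).IsContextFree) (x₀ : Γ.V) : Γ.IsContextFreeGraph x₀ := by
  obtain ⟨𝓛, r, hfin, hchain⟩ := exists_chain_of_isContextFree hΓ hL x₀
  exact isContextFreeGraph_of_finite _ (finite_range_ballData hfin (r + 1))
    fun v v' h => endIsomorphic_of_ballData_eq hΓ hchain h

end InvolutiveGraph

/-! ### Pushdown automata from encodings of the vertices -/

namespace InvolutiveGraph

variable {A : Type*} {Γ : InvolutiveGraph A} {x₀ : Γ.V}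

/-- An encoding of the vertices of a graph by configurations is local if the state and the top of
the stack determine which edges leave a vertex, and how the edges change the configuration. -/
def IsLocalEncoding {Q Θ : Type*} (Γ : InvolutiveGraph A) (enc : Γ.V → Q × List Θ) : Prop :=
  ∀ v₁ v₂ q x ξ₁ ξ₂, enc v₁ = (q, x :: ξ₁) → enc v₂ = (q, x :: ξ₂) → ∀ e₁, Γ.src e₁ = v₁ →
    ∃ e₂ p γ, Γ.src e₂ = v₂ ∧ Γ.lab e₂ = Γ.lab e₁ ∧ enc (Γ.tgt e₁) = (p, γ ++ ξ₁) ∧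
      enc (Γ.tgt e₂) = (p, γ ++ ξ₂)

/-- If the vertices of an inverse graph have a local encoding by configurations, then the graph is
the configurations graph of a pushdown automaton. -/
theorem exists_iso_configGraph_of_encoding (hΓ : Γ.IsInverse) {Q Θ : Type} [Finite Q] [Finite Θ]
    (enc : Γ.V → Q × List Θ) (hinj : Function.Injective enc) {q₀ : Q} {bot : Θ}
    (h₀ : enc x₀ = (q₀, [bot])) (hne : ∀ v, (enc v).2 ≠ []) (hloc : Γ.IsLocalEncoding enc) :
    ∃ (M : RealTimeDPDA (Letter A)) (hM : M.IsInverse) (φ : Iso (M.configGraph hM) Γ),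
      φ.onV (M.configRoot hM) = x₀ := by
  classical
  let rel : Q → Letter A → Θ → Q × List Θ → Prop := fun q a x r =>
    ∃ e ξ, enc (Γ.src e) = (q, x :: ξ) ∧ Γ.lab e = a ∧ enc (Γ.tgt e) = (r.1, r.2 ++ ξ)
  have hrel : ∀ {q a x r v ξ}, rel q a x r → enc v = (q, x :: ξ) →
      ∃ e, Γ.src e = v ∧ Γ.lab e = a ∧ enc (Γ.tgt e) = (r.1, r.2 ++ ξ) := by
    rintro q a x r v ξ ⟨e, ζ, hs, rfl, ht⟩ hv
    obtain ⟨e₂, p, γ, hs₂, hl₂, ht₁, ht₂⟩ := hloc _ _ _ _ _ _ hs hv e rfl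
    rw [ht, Prod.mk.injEq, List.append_cancel_right_eq] at ht₁
    exact ⟨e₂, hs₂, hl₂, by rw [ht₂, ht₁.1, ht₁.2]⟩
  have huniq : ∀ {q a x r r'}, rel q a x r → rel q a x r' → r = r' := by
    intro q a x r r' h h'
    obtain ⟨e, ξ, hs, hl, ht⟩ := h
    obtain ⟨e', hs', hl', ht'⟩ := hrel h' hs
    obtain rfl := hΓ.deterministic _ _ hs' (hl'.trans hl.symm)
    rw [ht', Prod.mk.injEq, List.append_cancel_right_eq] at ht
    exact (Prod.ext ht.1 ht.2).symm
  let M : RealTimeDPDA (Letter A) :=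
    { Q := Q
      Θ := Θ
      finite_Q := inferInstance
      finite_Θ := inferInstance
      δ := fun q a x => if h : ∃ r, rel q a x r then some h.choose else none
      q₀ := q₀
      bot := bot
      F := ∅ }
  have hδ : ∀ {q a x r}, M.δ q a x = some r ↔ rel q a x r := by
    intro q a x r
    change (if h : ∃ r, rel q a x r then some h.choose else none) = some r ↔ _
    split_ifs with h
    · rw [Option.some.injEq]
      exact ⟨fun hr => hr ▸ h.choose_spec, fun hr => huniq h.choose_spec hr⟩
    · exact ⟨fun hr => (nomatch hr), fun hr => absurd ⟨r, hr⟩ h⟩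
  have hstep : ∀ {v a c}, M.Step (enc v) a c ↔
      ∃ e, Γ.src e = v ∧ Γ.lab e = a ∧ enc (Γ.tgt e) = c := by
    intro v a c
    constructor
    · rintro ⟨x, ξ, γ, h₁, h₂, h₃⟩
      obtain ⟨e, hs, hl, ht⟩ := hrel (hδ.1 h₂) (Prod.ext rfl h₁ : enc v = (_, x :: ξ))
      exact ⟨e, hs, hl, ht.trans (Prod.ext rfl h₃.symm)⟩
    · rintro ⟨e, rfl, rfl, rfl⟩
      obtain ⟨x, ξ, hξ⟩ := List.exists_cons_of_ne_nil (hne (Γ.src e))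
      have hv : enc (Γ.src e) = ((enc (Γ.src e)).1, x :: ξ) := Prod.ext rfl hξ
      obtain ⟨_, p, γ, _, _, ht, _⟩ := hloc _ _ _ _ _ _ hv hv e rfl
      refine ⟨x, ξ, γ, hξ, hδ.2 ⟨e, ξ, hv, rfl, ?_⟩, ?_⟩
      · rw [ht]
      · rw [ht]
  have hreach : ∀ {c}, M.Reachable c ↔ ∃ v, enc v = c := by
    intro c
    constructor
    · intro h
      induction h with
      | refl => exact ⟨x₀, h₀⟩
      | tail _ hs ih =>
        obtain ⟨v, rfl⟩ := ih
        obtain ⟨a, hs⟩ := hs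
        obtain ⟨e, _, _, he⟩ := hstep.1 hs
        exact ⟨_, he⟩
    · rintro ⟨v, rfl⟩
      obtain ⟨w, hw⟩ := hΓ.connected x₀ v
      have hx₀ : M.Reachable (enc x₀) := by
        rw [h₀]
        exact Relation.ReflTransGen.refl
      clear h₀
      revert hx₀
      induction hw with
      | nil x => exact id
      | cons e _ ih => exact fun hx => ih (hx.tail ⟨_, hstep.2 ⟨e, rfl, rfl, rfl⟩⟩)
  have hinv : ∀ {v v' a}, M.Step (enc v) a (enc v') → M.Step (enc v') a.inv (enc v) := by
    intro v v' a h
    obtain ⟨e, rfl, rfl, he⟩ := hstep.1 h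
    obtain rfl := hinj he
    exact hstep.2 ⟨Γ.inv e, Γ.src_inv e, Γ.lab_inv e, by rw [Γ.tgt_inv]⟩
  have hM : M.IsInverse := by
    intro a c₁ c₂ h₁ h₂
    obtain ⟨v₁, rfl⟩ := hreach.1 h₁
    obtain ⟨v₂, rfl⟩ := hreach.1 h₂
    exact ⟨hinv, hinv⟩
  let f : Γ.V ≃ (M.configGraph hM).V :=
    Equiv.ofBijective (fun v => ⟨enc v, hreach.2 ⟨v, rfl⟩⟩)
      ⟨fun v v' h => hinj (congrArg Subtype.val h), fun c => by
        obtain ⟨v, hv⟩ := hreach.1 c.2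
        exact ⟨v, Subtype.ext hv⟩⟩
  have hedge : ∀ t : (M.configGraph hM).E, ∃ e, (M.configGraph hM).src t = f (Γ.src e) ∧
      (M.configGraph hM).lab t = Γ.lab e ∧ (M.configGraph hM).tgt t = f (Γ.tgt e) := by
    rintro ⟨⟨c, a, c'⟩, ht⟩
    obtain ⟨v, rfl⟩ := f.surjective c
    obtain ⟨e, rfl, rfl, he⟩ := hstep.1 ht
    exact ⟨e, rfl, rfl, Subtype.ext he.symm⟩
  obtain ⟨φ, hφ⟩ := exists_iso_of_equiv (Γ' := M.configGraph hM) hΓ.deterministic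
    (by
      intro t t' hs hl
      obtain ⟨e, h₁, h₂, h₃⟩ := hedge t
      obtain ⟨e', h₁', h₂', h₃'⟩ := hedge t'
      obtain rfl := hΓ.deterministic e e' (f.injective (h₁.symm.trans (hs.trans h₁')))
        (h₂.symm.trans (hl.trans h₂'))
      exact Subtype.ext (Prod.ext hs (Prod.ext hl (h₃.trans h₃'.symm)))) f
    (fun e => ⟨⟨(f (Γ.src e), Γ.lab e, f (Γ.tgt e)), hstep.2 ⟨e, rfl, rfl, rfl⟩⟩, rfl, rfl, rfl⟩)
    hedge
  refine ⟨M, hM, φ.symm, ?_⟩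
  change φ.onV.symm _ = _
  rw [hφ, Equiv.symm_apply_eq]
  exact Subtype.ext h₀.symm

theorem exists_injOn_finite {α : Type*} {S : Set α} (hS : S.Finite) :
    ∃ (X : Type) (_ : Finite X) (f : α → X), Set.InjOn f S := by
  classical
  have := hS.to_subtype
  obtain ⟨n, ⟨e⟩⟩ := Finite.exists_equiv_fin S
  refine ⟨Option (Fin n), inferInstance, fun a => if h : a ∈ S then some (e ⟨a, h⟩) else none, ?_⟩
  intro a ha b hb h
  simpa [ha, hb] using h

theorem map_injOn {α β : Type*} {S : Set α} {f : α → β} (hf : Set.InjOn f S) {l l' : List α}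
    (hl : ∀ x ∈ l, x ∈ S) (hl' : ∀ x ∈ l', x ∈ S) (h : l.map f = l'.map f) : l = l' := by
  induction l generalizing l' with
  | nil => exact (List.map_eq_nil_iff.1 h.symm).symm
  | cons x l ih =>
    obtain ⟨y, l'', rfl, h₁, h₂⟩ := List.map_eq_cons_iff.1 h.symm
    rw [hf (hl' y (by simp)) (hl x (by simp)) h₁,
      ih (fun z hz => hl z (by simp [hz])) (fun z hz => hl' z (by simp [hz])) h₂.symm]

/-- The states and stack symbols of a local encoding may come from arbitrary types as long as only
finitely many of them are used. -/
theorem exists_iso_configGraph_of_finite_encoding (hΓ : Γ.IsInverse) {Q Θ : Type*}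
    (enc : Γ.V → Q × List Θ) (hQ : (Set.range fun v => (enc v).1).Finite)
    (hΘ : {x | ∃ v, x ∈ (enc v).2}.Finite) (hinj : Function.Injective enc) {q₀ : Q} {bot : Θ}
    (h₀ : enc x₀ = (q₀, [bot])) (hne : ∀ v, (enc v).2 ≠ []) (hloc : Γ.IsLocalEncoding enc) :
    ∃ (M : RealTimeDPDA (Letter A)) (hM : M.IsInverse) (φ : Iso (M.configGraph hM) Γ),
      φ.onV (M.configRoot hM) = x₀ := by
  obtain ⟨Q', _, f, hf⟩ := exists_injOn_finite hQ
  obtain ⟨Θ', _, g, hg⟩ := exists_injOn_finite hΘ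
  refine exists_iso_configGraph_of_encoding hΓ (fun v => (f (enc v).1, (enc v).2.map g)) ?_
    (q₀ := f q₀) (bot := g bot) (by simp [h₀]) (by simpa using hne) ?_
  · intro v v' h
    rw [Prod.mk.injEq] at h
    exact hinj (Prod.ext (hf ⟨v, rfl⟩ ⟨v', rfl⟩ h.1)
      (map_injOn hg (fun x hx => ⟨v, hx⟩) (fun x hx => ⟨v', hx⟩) h.2))
  · intro v₁ v₂ q' x' ξ₁' ξ₂' h₁ h₂ e he
    simp only [Prod.mk.injEq, List.map_eq_cons_iff] at h₁ h₂
    obtain ⟨hq₁, x₁, ξ₁, h₁, hx₁, rfl⟩ := h₁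
    obtain ⟨hq₂, x₂, ξ₂, h₂, hx₂, rfl⟩ := h₂
    have hq : (enc v₁).1 = (enc v₂).1 := hf ⟨v₁, rfl⟩ ⟨v₂, rfl⟩ (hq₁.trans hq₂.symm)
    have hx : x₁ = x₂ := hg ⟨v₁, by simp [h₁]⟩ ⟨v₂, by simp [h₂]⟩ (hx₁.trans hx₂.symm)
    subst hx
    obtain ⟨e₂, p, γ, hs, hl, ht₁, ht₂⟩ := hloc v₁ v₂ (enc v₂).1 x₁ ξ₁ ξ₂ (Prod.ext hq h₁)
      (Prod.ext rfl h₂) e he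
    exact ⟨e₂, f p, γ.map g, hs, hl, by simp [ht₁], by simp [ht₂]⟩

/-! ### Types of vertices -/

section ConeType

variable {b b' y y' t t' : Γ.V} {s w : List (Letter A)}

theorem ConeWalk.of_coneType_eq (h : Γ.coneType x₀ b = Γ.coneType x₀ b')
    (hw : Γ.ConeWalk x₀ b w y) : ∃ y' k, Γ.ConeWalk x₀ b' w y' ∧
      Γ.dist x₀ y = Γ.dist x₀ b + k ∧ Γ.dist x₀ y' = Γ.dist x₀ b' + k := by
  obtain ⟨k, hk⟩ := Nat.exists_eq_add_of_le hw.dist_le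
  have hm : (w, w, k) ∈ Γ.coneType x₀ b := ⟨y, hw, hw, hk⟩
  rw [h] at hm
  obtain ⟨y', hy', _, hk'⟩ := hm
  exact ⟨y', k, hy', hk, hk'⟩

theorem dist_eq_of_coneType_eq (hΓ : Γ.IsInverse) (h : Γ.coneType x₀ b = Γ.coneType x₀ b')
    (hy : Γ.ConeWalk x₀ b w y) (hy' : Γ.ConeWalk x₀ b' w y') {k : ℕ}
    (hk : Γ.dist x₀ y = Γ.dist x₀ b + k) : Γ.dist x₀ y' = Γ.dist x₀ b' + k := by
  obtain ⟨z, j, hz, hj, hj'⟩ := hy.of_coneType_eq h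
  rw [hy'.right_unique hΓ hz]
  omega

/-- Vertices that the same word reaches from vertices of the same type are reached by the same
words. -/
theorem ConeWalk.of_coneType_eq_of_coneWalk (hΓ : Γ.IsInverse)
    (h : Γ.coneType x₀ b = Γ.coneType x₀ b') (hw : Γ.ConeWalk x₀ b w y)
    (hs : Γ.ConeWalk x₀ b s y) (hs' : Γ.ConeWalk x₀ b' s y') :
    Γ.ConeWalk x₀ b' w y' := by
  obtain ⟨k, hk⟩ := Nat.exists_eq_add_of_le hw.dist_le
  have hm : (w, s, k) ∈ Γ.coneType x₀ b := ⟨y, hw, hs, hk⟩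
  rw [h] at hm
  obtain ⟨z, hz, hz', _⟩ := hm
  rwa [hs'.right_unique hΓ hz']

theorem setOf_coneWalk_eq (hΓ : Γ.IsInverse) (h : Γ.coneType x₀ b = Γ.coneType x₀ b')
    (hs : Γ.ConeWalk x₀ b s y) (hs' : Γ.ConeWalk x₀ b' s y') :
    {w | Γ.ConeWalk x₀ b w y} = {w | Γ.ConeWalk x₀ b' w y'} :=
  Set.ext fun _ => ⟨fun hw => hw.of_coneType_eq_of_coneWalk hΓ h hs hs',
    fun hw => hw.of_coneType_eq_of_coneWalk hΓ h.symm hs' hs⟩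

theorem ConeWalk.shift (hΓ : Γ.IsInverse) (h : Γ.coneType x₀ b = Γ.coneType x₀ b')
    (hw : Γ.ConeWalk x₀ y w t) (hs : Γ.ConeWalk x₀ b s y) (hs' : Γ.ConeWalk x₀ b' s y') :
    ∃ t', Γ.ConeWalk x₀ y' w t' := by
  induction w using List.reverseRecOn generalizing t with
  | nil => exact ⟨y', .nil y'⟩
  | append_singleton w a ih =>
    obtain ⟨z, hz, hzt⟩ := ConeWalk.append_iff.1 hw
    obtain ⟨z', hz'⟩ := ih hz
    obtain ⟨t', k, ht', hk, hk'⟩ := (hs.append hw).of_coneType_eq h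
    have hzt' : Γ.Walk z' [a] t' := by
      refine Walk.of_append_left hΓ (v := s ++ w) ?_ (WalkIn.walk (hs'.append hz'))
      rw [List.append_assoc]
      exact WalkIn.walk ht'
    obtain ⟨j, hj⟩ := Nat.exists_eq_add_of_le hs.dist_le
    have hj' := dist_eq_of_coneType_eq hΓ h hs hs' hj
    have hle : Γ.dist x₀ y ≤ Γ.dist x₀ t := hw.dist_le
    obtain ⟨e, he⟩ := Walk.single_iff.1 hzt'
    refine ⟨t', ConeWalk.append_iff.2 ⟨z', hz', WalkIn.single_iff.2 ⟨hz'.mem_right, ?_, e, he⟩⟩⟩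
    show Γ.dist x₀ y' ≤ Γ.dist x₀ t'
    omega

/-- The type of a vertex determines the types of the vertices of its end-cone. -/
theorem coneType_eq_of_coneWalk (hΓ : Γ.IsInverse) (h : Γ.coneType x₀ b = Γ.coneType x₀ b')
    (hs : Γ.ConeWalk x₀ b s y) (hs' : Γ.ConeWalk x₀ b' s y') :
    Γ.coneType x₀ y = Γ.coneType x₀ y' := by
  have key : ∀ b b' y y', Γ.coneType x₀ b = Γ.coneType x₀ b' → Γ.ConeWalk x₀ b s y →
      Γ.ConeWalk x₀ b' s y' → Γ.coneType x₀ y ⊆ Γ.coneType x₀ y' := by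
    rintro b b' y y' h hs hs' ⟨w, w', k⟩ ⟨z, hw, hw', hk⟩
    dsimp only at hw hw' hk
    obtain ⟨t, ht⟩ := hw.shift hΓ h hs hs'
    obtain ⟨t', ht'⟩ := hw'.shift hΓ h hs hs'
    have := (hs.append hw').of_coneType_eq_of_coneWalk hΓ h (hs.append hw) (hs'.append ht)
    obtain rfl := (hs'.append ht').right_unique hΓ this
    obtain ⟨j, hj⟩ := Nat.exists_eq_add_of_le hs.dist_le
    have hj' := dist_eq_of_coneType_eq hΓ h hs hs' hj
    have hk' := dist_eq_of_coneType_eq hΓ h (hs.append hw) (hs'.append ht) (k := j + k) (by omega)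
    exact ⟨t', ht, ht', by dsimp only; omega⟩
  exact (key b b' y y' h hs hs').antisymm (key b' b y' y h.symm hs' hs)

/-- The words that lead from `b`, in the end-cone at `b`, to the frontier of the end-cone on the
next level that contains `v`. -/
def entryWords (Γ : InvolutiveGraph A) (x₀ b v : Γ.V) : Set (List (Letter A)) :=
  {w | ∃ y s, Γ.ConeWalk x₀ b w y ∧ Γ.dist x₀ y = Γ.dist x₀ b + 1 ∧ Γ.ConeWalk x₀ y s v}

theorem entryWords_congr {v v' : Γ.V}
    (h : Γ.WalkIn (Γ.outside x₀ (Γ.dist x₀ b + 1)) v w v') :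
    Γ.entryWords x₀ b v = Γ.entryWords x₀ b v' := by
  have key : ∀ {v v' w}, Γ.WalkIn (Γ.outside x₀ (Γ.dist x₀ b + 1)) v w v' →
      Γ.entryWords x₀ b v ⊆ Γ.entryWords x₀ b v' := by
    rintro v v' w h u ⟨y, s, hu, hy, hs⟩
    rw [← hy] at h
    exact ⟨y, s ++ w, hu, hy, ConeWalk.append_iff.2 ⟨v, hs, h⟩⟩
  exact (key h).antisymm (key h.inverse)

theorem entryWords_eq (hΓ : Γ.IsInverse) (h : Γ.coneType x₀ b = Γ.coneType x₀ b')
    (hs : Γ.ConeWalk x₀ b s t) (hs' : Γ.ConeWalk x₀ b' s t') :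
    Γ.entryWords x₀ b t = Γ.entryWords x₀ b' t' := by
  have key : ∀ b b' t t', Γ.coneType x₀ b = Γ.coneType x₀ b' → Γ.ConeWalk x₀ b s t →
      Γ.ConeWalk x₀ b' s t' → Γ.entryWords x₀ b t ⊆ Γ.entryWords x₀ b' t' := by
    rintro b b' t t' h hs hs' w ⟨y, u, hw, hy, hu⟩
    obtain ⟨y', _, hw', _⟩ := hw.of_coneType_eq h
    obtain ⟨t'', hu'⟩ := hu.shift hΓ h hw hw'
    have := (hw.append hu).of_coneType_eq_of_coneWalk hΓ h hs hs'
    obtain rfl := (hw'.append hu').right_unique hΓ this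
    exact ⟨y', u, hw', dist_eq_of_coneType_eq hΓ h hw hw' hy, hu'⟩
  exact (key b b' t t' h hs hs').antisymm (key b' b t' t h.symm hs' hs)

theorem entryWords_nonempty (hΓ : Γ.IsInverse) (hs : Γ.ConeWalk x₀ b s t)
    (hlt : Γ.dist x₀ b < Γ.dist x₀ t) : (Γ.entryWords x₀ b t).Nonempty := by
  obtain ⟨y, w, hy, hw, _⟩ := exists_walkIn_of_le_dist hΓ x₀ hlt
  refine ⟨s ++ invWord w, y, w, ?_, hy, ?_⟩
  · refine ConeWalk.append_iff.2 ⟨t, hs, hw.inverse.mono fun z hz => ?_⟩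
    exact (Nat.le_succ _).trans hz
  · unfold ConeWalk
    rwa [hy]

end ConeType

/-! ### The stack of a vertex -/

open Classical in
/-- A choice of an element of a set of words; the empty word if the set is empty. -/
noncomputable def pickWord (S : Set (List (Letter A))) : List (Letter A) :=
  if h : S.Nonempty then h.choose else []

/-- The end-cone on level `n` that contains `v` is recorded by a base point in its frontier and by
a stack. The stack symbol on each level consists of the type of the base point one level below and
of the words that lead from there to the frontier; the choice of one of these words, which depends
on the set of words alone, gives the next base point. -/
noncomputable def coneStack (Γ : InvolutiveGraph A) (x₀ : Γ.V) : ℕ → Γ.V →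
    Γ.V × List (Option (Set (List (Letter A) × List (Letter A) × ℕ) × Set (List (Letter A))))
  | 0, _ => (x₀, [none])
  | n + 1, v =>
    (Γ.walkEnd (coneStack Γ x₀ n v).1 (pickWord (Γ.entryWords x₀ (coneStack Γ x₀ n v).1 v)),
      some (Γ.coneType x₀ (coneStack Γ x₀ n v).1, Γ.entryWords x₀ (coneStack Γ x₀ n v).1 v) ::
        (coneStack Γ x₀ n v).2)

theorem length_coneStack (n : ℕ) (v : Γ.V) : (Γ.coneStack x₀ n v).2.length = n + 1 := by
  induction n with
  | zero => rfl
  | succ n ih => simp [coneStack, ih]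

theorem coneStack_succ_spec (hΓ : Γ.IsInverse) {b v : Γ.V} {s : List (Letter A)}
    (hs : Γ.ConeWalk x₀ b s v) (hlt : Γ.dist x₀ b < Γ.dist x₀ v) :
    Γ.ConeWalk x₀ b (pickWord (Γ.entryWords x₀ b v))
        (Γ.walkEnd b (pickWord (Γ.entryWords x₀ b v))) ∧
      Γ.dist x₀ (Γ.walkEnd b (pickWord (Γ.entryWords x₀ b v))) = Γ.dist x₀ b + 1 ∧
      ∃ s, Γ.ConeWalk x₀ (Γ.walkEnd b (pickWord (Γ.entryWords x₀ b v))) s v := by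
  have hne := entryWords_nonempty hΓ hs hlt
  have hp : pickWord (Γ.entryWords x₀ b v) ∈ Γ.entryWords x₀ b v := by
    rw [pickWord, dif_pos hne]
    exact hne.choose_spec
  obtain ⟨y, u, hw, hy, hu⟩ := hp
  rw [walkEnd_eq hΓ (WalkIn.walk hw)]
  exact ⟨hw, hy, u, hu⟩

theorem coneStack_spec (hΓ : Γ.IsInverse) {n : ℕ} {v : Γ.V} (hn : n ≤ Γ.dist x₀ v) :
    Γ.dist x₀ (Γ.coneStack x₀ n v).1 = n ∧ ∃ s, Γ.ConeWalk x₀ (Γ.coneStack x₀ n v).1 s v := by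
  induction n with
  | zero =>
    refine ⟨dist_self x₀, ?_⟩
    obtain ⟨w, hw⟩ := hΓ.connected x₀ v
    refine ⟨w, (walk_iff_walkIn.1 hw).mono fun z _ => ?_⟩
    show Γ.dist x₀ x₀ ≤ Γ.dist x₀ z
    rw [dist_self]
    exact Nat.zero_le _
  | succ n ih =>
    obtain ⟨hd, s, hs⟩ := ih (by omega)
    obtain ⟨_, h₂, h₃⟩ := coneStack_succ_spec hΓ hs (by omega)
    exact ⟨h₂.trans (by rw [hd]), h₃⟩

/-- The recorded data depend only on the end-cone. -/
theorem coneStack_congr (hΓ : Γ.IsInverse) {n : ℕ} {v v' : Γ.V} {w : List (Letter A)}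
    (h : Γ.WalkIn (Γ.outside x₀ n) v w v') : Γ.coneStack x₀ n v = Γ.coneStack x₀ n v' := by
  induction n with
  | zero => rfl
  | succ n ih =>
    have ih' := ih (h.mono fun z hz => (Nat.le_succ n).trans hz)
    have hd := (coneStack_spec hΓ ((Nat.le_succ n).trans h.mem_left : n ≤ Γ.dist x₀ v)).1
    have he : Γ.entryWords x₀ (Γ.coneStack x₀ n v).1 v =
        Γ.entryWords x₀ (Γ.coneStack x₀ n v).1 v' :=
      entryWords_congr (w := w) (by rwa [hd])
    simp only [coneStack]
    rw [he, ih']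

theorem coneStack_fst_eq {n : ℕ} {v v' : Γ.V}
    (h : (Γ.coneStack x₀ n v).2 = (Γ.coneStack x₀ n v').2) :
    (Γ.coneStack x₀ n v).1 = (Γ.coneStack x₀ n v').1 := by
  induction n with
  | zero => rfl
  | succ n ih =>
    simp only [coneStack, List.cons.injEq, Option.some.injEq, Prod.mk.injEq] at h ⊢
    rw [h.1.2, ih h.2]

/-- The configuration of a vertex `v`: the stack of the end-cone at `v` and, as a state, the words
that lead to `v` from the base point of this end-cone. -/
noncomputable def encode (Γ : InvolutiveGraph A) (x₀ v : Γ.V) : Set (List (Letter A)) ×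
    List (Option (Set (List (Letter A) × List (Letter A) × ℕ) × Set (List (Letter A)))) :=
  ({w | Γ.ConeWalk x₀ (Γ.coneStack x₀ (Γ.dist x₀ v) v).1 w v},
    (Γ.coneStack x₀ (Γ.dist x₀ v) v).2)

theorem encode_injective (hΓ : Γ.IsInverse) : Function.Injective (Γ.encode x₀) := by
  intro v v' h
  obtain ⟨h₁, h₂⟩ := Prod.mk.inj h
  have hd : Γ.dist x₀ v = Γ.dist x₀ v' := by
    have := congrArg List.length h₂
    rw [length_coneStack, length_coneStack] at this
    omega
  rw [← hd] at h₁ h₂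
  rw [← coneStack_fst_eq h₂] at h₁
  obtain ⟨_, s, hs⟩ := coneStack_spec hΓ (le_refl (Γ.dist x₀ v))
  exact hs.right_unique hΓ ((Set.ext_iff.1 h₁ s).1 hs)

theorem encode_of_dist_eq {n : ℕ} {v : Γ.V} (h : Γ.dist x₀ v = n) :
    Γ.encode x₀ v = ({w | Γ.ConeWalk x₀ (Γ.coneStack x₀ n v).1 w v}, (Γ.coneStack x₀ n v).2) := by
  rw [← h]
  rfl

theorem encode_isLocalEncoding (hΓ : Γ.IsInverse) : Γ.IsLocalEncoding (Γ.encode x₀) := by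
  rintro v₁ v₂ q x ξ₁ ξ₂ h₁ h₂ e he
  rcases hn₁ : Γ.dist x₀ v₁ with _ | n₁ <;> rcases hn₂ : Γ.dist x₀ v₂ with _ | n₂
  · obtain rfl := (dist_eq_zero hΓ).1 hn₁
    obtain rfl := (dist_eq_zero hΓ).1 hn₂
    obtain ⟨-, h⟩ := Prod.mk.inj ((encode_of_dist_eq hn₁).symm.trans h₁)
    obtain ⟨-, h'⟩ := Prod.mk.inj ((encode_of_dist_eq hn₁).symm.trans h₂)
    simp only [coneStack, List.cons.injEq] at h h'
    obtain ⟨-, rfl⟩ := h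
    obtain ⟨-, rfl⟩ := h'
    exact ⟨e, (Γ.encode x₀ (Γ.tgt e)).1, (Γ.encode x₀ (Γ.tgt e)).2, he, rfl, by simp, by simp⟩
  · rw [encode_of_dist_eq hn₁] at h₁
    rw [encode_of_dist_eq hn₂] at h₂
    simp only [coneStack, Prod.mk.injEq, List.cons.injEq] at h₁ h₂
    cases h₁.2.1.trans h₂.2.1.symm
  · rw [encode_of_dist_eq hn₁] at h₁
    rw [encode_of_dist_eq hn₂] at h₂
    simp only [coneStack, Prod.mk.injEq, List.cons.injEq] at h₁ h₂
    cases h₁.2.1.trans h₂.2.1.symm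
  rw [encode_of_dist_eq hn₁] at h₁
  rw [encode_of_dist_eq hn₂] at h₂
  obtain ⟨hq₁, hx₁⟩ := Prod.mk.inj h₁
  obtain ⟨hq₂, hx₂⟩ := Prod.mk.inj h₂
  have hstack₁ := hx₁
  have hstack₂ := hx₂
  simp only [coneStack, List.cons.injEq] at hx₁ hx₂
  obtain ⟨hx₁, rfl⟩ := hx₁
  obtain ⟨hx₂, rfl⟩ := hx₂
  obtain ⟨htype, hentry⟩ := Prod.mk.inj (Option.some.inj (hx₁.trans hx₂.symm))
  obtain ⟨hb₁, s₁, hs₁⟩ := coneStack_spec hΓ (by omega : n₁ ≤ Γ.dist x₀ v₁)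
  obtain ⟨hb₂, s₂, hs₂⟩ := coneStack_spec hΓ (by omega : n₂ ≤ Γ.dist x₀ v₂)
  obtain ⟨hg₁, hc₁, h, hh₁⟩ := coneStack_succ_spec hΓ hs₁ (by omega)
  obtain ⟨hg₂, hc₂, -⟩ := coneStack_succ_spec hΓ hs₂ (by omega)
  have hh₂ : h ∈ {w | Γ.ConeWalk x₀ (Γ.coneStack x₀ (n₂ + 1) v₂).1 w v₂} := by
    rw [hq₂, ← hq₁]
    exact hh₁
  change Γ.ConeWalk x₀ (Γ.coneStack x₀ (n₁ + 1) v₁).1 h v₁ at hh₁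
  change Γ.ConeWalk x₀ (Γ.coneStack x₀ (n₂ + 1) v₂).1 h v₂ at hh₂
  change Γ.ConeWalk x₀ _ _ (Γ.coneStack x₀ (n₁ + 1) v₁).1 at hg₁
  change Γ.ConeWalk x₀ _ _ (Γ.coneStack x₀ (n₂ + 1) v₂).1 at hg₂
  change Γ.dist x₀ (Γ.coneStack x₀ (n₁ + 1) v₁).1 = _ at hc₁
  change Γ.dist x₀ (Γ.coneStack x₀ (n₂ + 1) v₂).1 = _ at hc₂
  rw [← hentry] at hg₂
  have htype' := coneType_eq_of_coneWalk hΓ htype hg₁ hg₂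
  have hcd₁ : Γ.dist x₀ (Γ.coneStack x₀ (n₁ + 1) v₁).1 = n₁ + 1 := by rw [hc₁, hb₁]
  have hcd₂ : Γ.dist x₀ (Γ.coneStack x₀ (n₂ + 1) v₂).1 = n₂ + 1 := by rw [hc₂, hb₂]
  -- the edge at `v₁` and the corresponding edge at `v₂`
  subst he
  have hle := dist_le_dist_add_length' hΓ x₀ (Walk.edge e)
  rw [List.length_singleton] at hle
  have hedge₁ : Γ.WalkIn (Γ.outside x₀ n₁) (Γ.src e) [Γ.lab e] (Γ.tgt e) := by
    refine WalkIn.single_iff.2 ⟨?_, ?_, e, rfl, rfl, rfl⟩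
    · show n₁ ≤ Γ.dist x₀ (Γ.src e)
      omega
    · show n₁ ≤ Γ.dist x₀ (Γ.tgt e)
      omega
  have hw₁ : Γ.ConeWalk x₀ (Γ.coneStack x₀ n₁ (Γ.src e)).1
      (pickWord (Γ.entryWords x₀ (Γ.coneStack x₀ n₁ (Γ.src e)).1 (Γ.src e)) ++ h ++ [Γ.lab e])
      (Γ.tgt e) :=
    ConeWalk.append_iff.2 ⟨_, hg₁.append hh₁, by rwa [hb₁]⟩
  obtain ⟨t₂, k, hw₂, hk₁, hk₂⟩ := hw₁.of_coneType_eq htype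
  rw [hb₁] at hk₁
  rw [hb₂] at hk₂
  obtain ⟨z, hz, hedge₂⟩ := ConeWalk.append_iff.1 hw₂
  obtain rfl := (hg₂.append hh₂).right_unique hΓ hz
  rw [hb₂] at hedge₂
  obtain ⟨_, _, e₂, rfl, hl₂, rfl⟩ := WalkIn.single_iff.1 hedge₂
  have hk : k ≤ 2 := by
    have := dist_le_dist_add_length hΓ x₀ (Walk.edge e)
    rw [List.length_singleton] at this
    omega
  rcases Nat.eq_zero_or_pos k with rfl | hkpos
  · -- a step towards the root
    refine ⟨e₂, {w | Γ.ConeWalk x₀ (Γ.coneStack x₀ n₁ (Γ.src e)).1 w (Γ.tgt e)}, [], rfl, hl₂,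
      ?_, ?_⟩
    · rw [encode_of_dist_eq (n := n₁) hk₁, ← coneStack_congr hΓ hedge₁]
      rfl
    · rw [encode_of_dist_eq (n := n₂) hk₂, ← coneStack_congr hΓ hedge₂,
        setOf_coneWalk_eq hΓ htype hw₁ hw₂]
      rfl
  have up : ∀ {n : ℕ} {e : Γ.E}, n + 1 ≤ Γ.dist x₀ (Γ.src e) → n + 1 ≤ Γ.dist x₀ (Γ.tgt e) →
      Γ.WalkIn (Γ.outside x₀ (n + 1)) (Γ.src e) [Γ.lab e] (Γ.tgt e) := fun h h' =>
    WalkIn.single_iff.2 ⟨h, h', _, rfl, rfl, rfl⟩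
  have hedge₁' := up (n := n₁) (e := e) (by omega) (by omega)
  have hedge₂' := up (n := n₂) (e := e₂) (by omega) (by omega)
  have hh₁' : Γ.ConeWalk x₀ (Γ.coneStack x₀ (n₁ + 1) (Γ.src e)).1 (h ++ [Γ.lab e]) (Γ.tgt e) :=
    ConeWalk.append_iff.2 ⟨_, hh₁, by rwa [hcd₁]⟩
  have hh₂' : Γ.ConeWalk x₀ (Γ.coneStack x₀ (n₂ + 1) (Γ.src e₂)).1 (h ++ [Γ.lab e])
      (Γ.tgt e₂) :=
    ConeWalk.append_iff.2 ⟨_, hh₂, by rwa [hcd₂, ← hl₂]⟩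
  have hcs₁ := coneStack_congr hΓ hedge₁'
  have hcs₂ := coneStack_congr hΓ hedge₂'
  obtain rfl | rfl : k = 1 ∨ k = 2 := by omega
  · -- a step inside the frontier
    refine ⟨e₂, {w | Γ.ConeWalk x₀ (Γ.coneStack x₀ (n₁ + 1) (Γ.src e)).1 w (Γ.tgt e)}, [x], rfl,
      hl₂, ?_, ?_⟩
    · rw [encode_of_dist_eq hk₁, ← hcs₁, hstack₁]
      rfl
    · rw [encode_of_dist_eq hk₂, ← hcs₂, hstack₂, setOf_coneWalk_eq hΓ htype' hh₁' hh₂']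
      rfl
  · -- a step away from the root, into an end-cone on the next level
    have hentry' := entryWords_eq hΓ htype' hh₁' hh₂'
    obtain ⟨hg₁', -, s, hs₁'⟩ := coneStack_succ_spec hΓ hh₁' (by omega)
    obtain ⟨hg₂', -, -⟩ := coneStack_succ_spec hΓ hh₂' (by omega)
    rw [← hentry'] at hg₂'
    have htype'' := coneType_eq_of_coneWalk hΓ htype' hg₁' hg₂'
    obtain ⟨t, hs₂'⟩ := hs₁'.shift hΓ htype' hg₁' hg₂'
    obtain rfl := (hg₂'.append hs₂').right_unique hΓ
      ((hg₁'.append hs₁').of_coneType_eq_of_coneWalk hΓ htype' hh₁' hh₂')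
    have hset := setOf_coneWalk_eq hΓ htype'' hs₁' hs₂'
    refine ⟨e₂, {w | Γ.ConeWalk x₀ (Γ.walkEnd (Γ.coneStack x₀ (n₁ + 1) (Γ.src e)).1
      (pickWord (Γ.entryWords x₀ (Γ.coneStack x₀ (n₁ + 1) (Γ.src e)).1 (Γ.tgt e)))) w (Γ.tgt e)},
      [some (Γ.coneType x₀ (Γ.coneStack x₀ (n₁ + 1) (Γ.src e)).1,
      Γ.entryWords x₀ (Γ.coneStack x₀ (n₁ + 1) (Γ.src e)).1 (Γ.tgt e)), x], rfl, hl₂, ?_, ?_⟩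
    · rw [encode_of_dist_eq hk₁, coneStack, ← hcs₁, hstack₁]
      rfl
    · rw [encode_of_dist_eq hk₂, coneStack, ← hcs₂, hstack₂, ← hentry', ← htype', ← hset]
      rfl

/-! ### Finiteness of the encoding -/

theorem finite_setOf_mem_encode [Finite A] (hΓ : Γ.IsInverse)
    (h : (Set.range (Γ.coneType x₀)).Finite) : (Set.range fun v => (Γ.encode x₀ v).1).Finite ∧
      {x | ∃ v, x ∈ (Γ.encode x₀ v).2}.Finite := by
  -- a finite set of vertices of all types
  have := h.to_subtype
  let B := Set.range (Set.rangeSplitting (Γ.coneType x₀))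
  have hB : B.Finite := Set.finite_range _
  have hrep : ∀ b, ∃ b' ∈ B, Γ.coneType x₀ b = Γ.coneType x₀ b' := fun b =>
    ⟨_, ⟨⟨_, b, rfl⟩, rfl⟩, (Set.apply_rangeSplitting (Γ.coneType x₀) ⟨_, b, rfl⟩).symm⟩
  constructor
  · refine (hB.biUnion fun b _ => (finite_setOf_dist_le hΓ x₀ (Γ.dist x₀ b)).image
      fun y => {w | Γ.ConeWalk x₀ b w y}).subset ?_
    rintro _ ⟨v, rfl⟩
    obtain ⟨hd, s, hs⟩ := coneStack_spec hΓ (le_refl (Γ.dist x₀ v))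
    obtain ⟨b, hb, hbt⟩ := hrep (Γ.coneStack x₀ (Γ.dist x₀ v) v).1
    obtain ⟨y, k, hy, hk, hk'⟩ := hs.of_coneType_eq hbt
    exact Set.mem_biUnion hb ⟨y, show Γ.dist x₀ y ≤ Γ.dist x₀ b by omega,
      (setOf_coneWalk_eq hΓ hbt hs hy).symm⟩
  · refine (((hB.biUnion fun b _ => (finite_setOf_dist_le hΓ x₀ (Γ.dist x₀ b + 1)).image
      fun y => some (Γ.coneType x₀ b, Γ.entryWords x₀ b y))).insert none).subset ?_
    have key : ∀ n v, n ≤ Γ.dist x₀ v → ∀ x ∈ (Γ.coneStack x₀ n v).2, x = none ∨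
        x ∈ ⋃ b ∈ B, (fun y => some (Γ.coneType x₀ b, Γ.entryWords x₀ b y)) ''
          {y | Γ.dist x₀ y ≤ Γ.dist x₀ b + 1} := by
      intro n v
      induction n with
      | zero => exact fun _ x hx => Or.inl (List.mem_singleton.1 hx)
      | succ n ih =>
        intro hn x hx
        rcases List.mem_cons.1 hx with rfl | hx
        · obtain ⟨hd, s, hs⟩ := coneStack_spec hΓ ((Nat.le_succ n).trans hn)
          obtain ⟨b, hb, hbt⟩ := hrep (Γ.coneStack x₀ n v).1
          obtain ⟨w, y, u, hw, hy, hu⟩ := entryWords_nonempty hΓ hs (by omega)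
          obtain ⟨y', k, hy', hk, hk'⟩ := hw.of_coneType_eq hbt
          refine Or.inr (Set.mem_biUnion hb ⟨y', show Γ.dist x₀ y' ≤ Γ.dist x₀ b + 1 by omega, ?_⟩)
          have hv : Γ.entryWords x₀ (Γ.coneStack x₀ n v).1 y =
              Γ.entryWords x₀ (Γ.coneStack x₀ n v).1 v :=
            entryWords_congr (w := u) (by rw [← hy]; exact hu)
          simp only
          rw [← hv, ← hbt, entryWords_eq hΓ hbt hw hy']
        · exact ih (by omega) x hx
    rintro x ⟨v, hx⟩
    exact key _ v le_rfl x hx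

/-- A graph that is context-free in the sense of Muller and Schupp is the configurations graph of a
pushdown automaton. -/
theorem IsContextFreeGraph.exists_iso_configGraph [Finite A] (hΓ : Γ.IsInverse)
    (h : Γ.IsContextFreeGraph x₀) :
    ∃ (M : RealTimeDPDA (Letter A)) (hM : M.IsInverse) (φ : Iso (M.configGraph hM) Γ),
      φ.onV (M.configRoot hM) = x₀ := by
  obtain ⟨h₁, h₂⟩ := finite_setOf_mem_encode hΓ (h.finite_range_coneType hΓ)
  refine exists_iso_configGraph_of_finite_encoding hΓ (Γ.encode x₀) h₁ h₂ (encode_injective hΓ)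
    (bot := none) (Prod.ext rfl ?_) (fun v => ?_) (encode_isLocalEncoding hΓ)
  · rw [encode_of_dist_eq (dist_self x₀)]
    rfl
  · refine List.ne_nil_of_length_pos ?_
    simp only [encode, length_coneStack]
    exact Nat.succ_pos _

end InvolutiveGraph

/-! ### Pushdown automata have context-free languages -/

namespace RealTimeDPDA

variable {B : Type*} {M : RealTimeDPDA B}

/-- `M.Run c w c'`: the automaton passes from `c` to `c'` by reading the word `w`. -/
inductive Run (M : RealTimeDPDA B) : M.Config → List B → M.Config → Prop
  | nil (c : M.Config) : Run M c [] c
  | cons {c c' c'' : M.Config} {a : B} {w : List B} :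
      M.Step c a c' → Run M c' w c'' → Run M c (a :: w) c''

theorem Run.append {c c' c'' : M.Config} {v w : List B} (h₁ : M.Run c v c') (h₂ : M.Run c' w c'') :
    M.Run c (v ++ w) c'' := by
  induction h₁ with
  | nil _ => exact h₂
  | cons h _ ih => exact .cons h (ih h₂)

theorem Run.append_stack {c c' : M.Config} {w : List B} (h : M.Run c w c') (ζ : List M.Θ) :
    M.Run (c.1, c.2 ++ ζ) w (c'.1, c'.2 ++ ζ) := by
  induction h with
  | nil _ => exact .nil _
  | cons h _ ih =>
    obtain ⟨x, ξ, γ, h₁, h₂, h₃⟩ := h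
    refine .cons ?_ ih
    refine ⟨x, ξ ++ ζ, γ, ?_, h₂, ?_⟩
    · simp [h₁]
    · simp [h₃]

/-- A run on a stack that is split in two either never touches the lower part, or first empties the
upper part. -/
theorem Run.cases_append {p q : M.Q} {η ξ γ : List M.Θ} {w : List B}
    (h : M.Run (p, η ++ ξ) w (q, γ)) :
    (∃ γ', γ = γ' ++ ξ ∧ M.Run (p, η) w (q, γ')) ∨
      ∃ w₁ w₂ r, w = w₁ ++ w₂ ∧ M.Run (p, η) w₁ (r, []) ∧ M.Run (r, ξ) w₂ (q, γ) := by
  induction w generalizing p η with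
  | nil =>
    cases h
    exact Or.inl ⟨η, rfl, .nil _⟩
  | cons a w ih =>
    cases η with
    | nil => exact Or.inr ⟨[], a :: w, p, rfl, .nil _, h⟩
    | cons x η =>
      obtain _ | ⟨hs, hr⟩ := h
      rename_i c
      obtain ⟨p', ξ'⟩ := c
      obtain ⟨y, ζ, δ, h₁, h₂, h₃⟩ := hs
      simp only [List.cons_append, List.cons.injEq] at h₁ h₃
      obtain ⟨rfl, rfl⟩ := h₁
      subst h₃
      rw [← List.append_assoc] at hr
      have hs' : M.Step (p, x :: η) a (p', δ ++ η) := ⟨x, η, δ, rfl, h₂, rfl⟩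
      rcases ih hr with ⟨γ', rfl, hγ⟩ | ⟨w₁, w₂, r, rfl, hr₁, hr₂⟩
      · exact Or.inl ⟨γ', rfl, .cons hs' hγ⟩
      · exact Or.inr ⟨a :: w₁, w₂, r, rfl, .cons hs' hr₁, hr₂⟩

/-- The stacks from which the runs are decomposed: single symbols and the parts of the words that
the automaton pushes. -/
def sourceStacks (M : RealTimeDPDA B) : Set (List M.Θ) :=
  {ξ | ξ = [] ∨ (∃ x, ξ = [x]) ∨ ∃ p a x p' η, M.δ p a x = some (p', η) ∧ ξ <:+ η}

theorem finite_sourceStacks [Finite B] : M.sourceStacks.Finite := by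
  have := M.finite_Q
  have := M.finite_Θ
  have h : (⋃ t : M.Q × B × M.Θ, ⋃ o ∈ {o | M.δ t.1 t.2.1 t.2.2 = some o},
      {ξ : List M.Θ | ξ <:+ o.2}).Finite :=
    Set.finite_iUnion fun t => Set.Finite.biUnion
      (Set.Subsingleton.finite fun o ho o' ho' => Option.some.inj (ho.symm.trans ho'))
      fun o _ => (List.finite_toSet o.2.tails).subset fun ξ hξ => (List.mem_tails _ _).2 hξ
  refine (((Set.finite_range fun x : M.Θ => [x]).union h).insert []).subset ?_
  rintro ξ (rfl | ⟨x, rfl⟩ | ⟨p, a, x, p', η, hδ, hξ⟩)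
  · exact Or.inl rfl
  · exact Or.inr (Or.inl ⟨x, rfl⟩)
  · exact Or.inr (Or.inr (Set.mem_iUnion.2 ⟨(p, a, x), Set.mem_biUnion hδ hξ⟩))

theorem mem_sourceStacks_of_cons {x : M.Θ} {ξ : List M.Θ} (h : x :: ξ ∈ M.sourceStacks) :
    ξ ∈ M.sourceStacks := by
  rcases h with h | ⟨y, h⟩ | ⟨p, a, y, p', η, hδ, hξ⟩
  · cases h
  · cases h
    exact Or.inl rfl
  · exact Or.inr (Or.inr ⟨p, a, y, p', η, hδ, List.IsSuffix.trans ⟨[x], rfl⟩ hξ⟩)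

/-- The stacks in which the runs to `F` are decomposed: the upper parts of the stacks of `F`. -/
def targetStacks (M : RealTimeDPDA B) (F : Set M.Config) : Set (List M.Θ) :=
  {γ | γ = [] ∨ ∃ c ∈ F, γ <+: c.2}

theorem finite_targetStacks {F : Set M.Config} (hF : F.Finite) : (M.targetStacks F).Finite := by
  have h : (⋃ c ∈ F, {γ : List M.Θ | γ <+: c.2}).Finite :=
    hF.biUnion fun c _ =>
      (List.finite_toSet c.2.inits).subset fun γ hγ => (List.mem_inits _ _).2 hγ
  refine (h.insert []).subset ?_
  rintro γ (rfl | ⟨c, hc, hγ⟩)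
  · exact Or.inl rfl
  · exact Or.inr (Set.mem_biUnion hc hγ)

theorem mem_targetStacks_of_append {F : Set M.Config} {γ ξ : List M.Θ}
    (h : γ ++ ξ ∈ M.targetStacks F) : γ ∈ M.targetStacks F := by
  rcases h with h | ⟨c, hc, h⟩
  · exact Or.inl (List.append_eq_nil_iff.1 h).1
  · exact Or.inr ⟨c, hc, (List.prefix_append γ ξ).trans h⟩

/-- The nonterminals for the runs of `M` to `F`. The nonterminal `some (p, ξ, q, γ)` stands for the
words read from the state `p` with stack `ξ` to the state `q` with stack `γ`, and `none` for those
read from the initial configuration to `F`. -/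
abbrev RunSymbol (M : RealTimeDPDA B) (F : Set M.Config) :=
  Option (M.Q × {ξ // ξ ∈ M.sourceStacks} × M.Q × {γ // γ ∈ M.targetStacks F})

/-- The words for which a nonterminal stands. -/
def runLang (M : RealTimeDPDA B) (F : Set M.Config) : M.RunSymbol F → Language B
  | none => {w | ∃ c ∈ F, M.Run M.init w c}
  | some (p, ξ, q, γ) => {w | M.Run (p, ξ) w (q, γ)}

/-- The words that lead to a finite set of configurations form a context-free language. -/
theorem isContextFree_run [Finite B] (M : RealTimeDPDA B) {F : Set M.Config} (hF : F.Finite) :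
    Language.IsContextFree {w | ∃ c ∈ F, M.Run M.init w c} := by
  have := M.finite_Q
  have := M.finite_sourceStacks.to_subtype
  have := (M.finite_targetStacks hF).to_subtype
  refine ⟨soundGrammar (M.runLang F) none, language_soundGrammar ?_⟩
  have key : ∀ (n m : ℕ) (w : List B) (p q : M.Q) (ξ γ : List M.Θ) (hξ : ξ ∈ M.sourceStacks)
      (hγ : γ ∈ M.targetStacks F), w.length ≤ n → ξ.length ≤ m → M.Run (p, ξ) w (q, γ) →
      (soundGrammar (M.runLang F) none).Yields
        [.nonterminal (some (p, ⟨ξ, hξ⟩, q, ⟨γ, hγ⟩))] w := by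
    intro n
    induction n with
    | zero =>
      intro m w p q ξ γ hξ hγ hw _ h
      obtain rfl : w = [] := List.length_eq_zero_iff.1 (Nat.le_zero.1 hw)
      refine yields_of_symbolsMatch (σ := []) (by simp) ?_ .nil
      rintro w rfl
      exact h
    | succ n ihn =>
      intro m
      induction m with
      | zero =>
        intro w p q ξ γ hξ hγ hw hm h
        obtain rfl : ξ = [] := List.length_eq_zero_iff.1 (Nat.le_zero.1 hm)
        cases h with
        | nil =>
          refine yields_of_symbolsMatch (σ := []) (by simp) ?_ .nil
          rintro w rfl
          exact .nil _
        | cons hs _ =>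
          obtain ⟨x, ξ, γ, h₁, _⟩ := hs
          cases h₁
      | succ m ihm =>
        intro w p q ξ γ hξ hγ hw hm h
        match ξ, hξ, hm, h with
        | [], hξ, _, h => exact ihm w p q [] γ hξ hγ hw (by simp) h
        | [x], hξ, _, h =>
          cases h with
          | nil =>
            refine yields_of_symbolsMatch (σ := []) (by simp) ?_ .nil
            rintro w rfl
            exact .nil _
          | @cons _ c _ a w hs hr =>
            obtain ⟨p', ξ'⟩ := c
            obtain ⟨y, ζ, η, h₁, h₂, h₃⟩ := hs
            simp only [List.cons.injEq] at h₁ h₂ h₃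
            obtain ⟨rfl, rfl⟩ := h₁
            rw [List.append_nil] at h₃
            subst h₃
            have hξ' : ξ' ∈ M.sourceStacks :=
              Or.inr (Or.inr ⟨p, a, x, p', ξ', h₂, List.suffix_rfl⟩)
            have hy := ihn ξ'.length w p' q ξ' γ hξ' hγ (by simpa using hw) le_rfl hr
            refine yields_of_symbolsMatch
              (σ := [.terminal a, .nonterminal (some (p', ⟨ξ', hξ'⟩, q, ⟨γ, hγ⟩))]) (by simp) ?_
              (.terminal a hy)
            rintro _ ⟨_, rfl, u, _, rfl, hu, rfl⟩
            rw [List.append_nil]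
            exact .cons ⟨x, [], ξ', rfl, h₂, by simp⟩ hu
        | x :: y :: ξ, hξ, hm, h =>
          have hx : [x] ∈ M.sourceStacks := Or.inr (Or.inl ⟨x, rfl⟩)
          have hξ' := mem_sourceStacks_of_cons hξ
          rcases Run.cases_append (η := [x]) h with ⟨γ, rfl, hr⟩ | ⟨w₁, w₂, r, rfl, hr₁, hr₂⟩
          · have hγ' := mem_targetStacks_of_append hγ
            have hy := ihm w p q [x] γ hx hγ' hw (by simp at hm ⊢; omega) hr
            refine yields_of_symbolsMatch
              (σ := [.nonterminal (some (p, ⟨[x], hx⟩, q, ⟨γ, hγ'⟩))]) (by simp) ?_ hy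
            rintro _ ⟨u, _, rfl, hu, rfl⟩
            rw [List.append_nil]
            exact Run.append_stack hu (y :: ξ)
          · have hnil : [] ∈ M.targetStacks F := Or.inl rfl
            rw [List.length_append] at hw
            have hy₁ := ihm w₁ p r [x] [] hx hnil (by omega) (by simp at hm ⊢; omega) hr₁
            have hy₂ := ihm w₂ r q (y :: ξ) γ hξ' hγ (by omega) (by simpa using hm) hr₂
            refine yields_of_symbolsMatch le_rfl ?_ (hy₁.append hy₂)
            rintro _ ⟨u, _, rfl, hu, v, _, rfl, hv, rfl⟩
            rw [List.append_nil]
            exact (Run.append_stack hu (y :: ξ)).append hv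
  rintro w ⟨⟨q, γ⟩, hc, hw⟩
  have hbot : [M.bot] ∈ M.sourceStacks := Or.inr (Or.inl ⟨_, rfl⟩)
  have hγ : γ ∈ M.targetStacks F := Or.inr ⟨_, hc, List.prefix_rfl⟩
  refine yields_of_symbolsMatch
    (σ := [.nonterminal (some (M.q₀, ⟨[M.bot], hbot⟩, q, ⟨γ, hγ⟩))]) (by simp) ?_
    (key _ _ w _ _ _ _ hbot hγ le_rfl le_rfl hw)
  rintro _ ⟨u, _, rfl, hu, rfl⟩
  rw [List.append_nil]
  exact ⟨(q, γ), hc, hu⟩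

end RealTimeDPDA

namespace InvolutiveGraph

open RealTimeDPDA

variable {A : Type*} {M : RealTimeDPDA (Letter A)}

theorem configGraph_walk_iff (hM : M.IsInverse) {x y : (M.configGraph hM).V}
    {w : List (Letter A)} : (M.configGraph hM).Walk x w y ↔ M.Run x.1 w y.1 := by
  constructor
  · intro h
    induction h with
    | nil x => exact .nil _
    | cons e _ ih => exact .cons e.2 ih
  · obtain ⟨c, hc⟩ := x
    obtain ⟨c', hc'⟩ := y
    intro h
    dsimp only at h
    induction h with
    | nil _ => exact .nil _
    | @cons c c₁ _ a w hs _ ih =>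
      have h₁ : M.Reachable c₁ := hc.tail ⟨a, hs⟩
      exact Walk.cons_iff.2 ⟨⟨(⟨c, hc⟩, a, ⟨c₁, h₁⟩), hs⟩, rfl, rfl, ih h₁ hc'⟩

/-- The languages of a graph that is isomorphic to a configurations graph are context-free. -/
theorem isContextFree_langTo_of_iso [Finite A] {Γ : InvolutiveGraph A} {x₀ : Γ.V}
    (hM : M.IsInverse) (φ : Iso (M.configGraph hM) Γ) (hφ : φ.onV (M.configRoot hM) = x₀)
    {F : Set Γ.V} (hF : F.Finite) : (Γ.langTo x₀ F).IsContextFree := by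
  have h := M.isContextFree_run (hF.image fun y => (φ.onV.symm y).1)
  refine (congrArg Language.IsContextFree (Set.ext fun w => ?_)).mp h
  refine Iff.symm ?_
  constructor
  · rintro ⟨y, hy, hw⟩
    refine ⟨_, ⟨y, hy, rfl⟩, (configGraph_walk_iff hM (x := M.configRoot hM)).1 ?_⟩
    have := hw.map φ.symm
    rwa [← hφ, Iso.symm, Equiv.symm_apply_apply] at this
  · rintro ⟨_, ⟨y, hy, rfl⟩, hw⟩
    refine ⟨y, hy, ?_⟩
    have := ((configGraph_walk_iff hM (x := M.configRoot hM)).2 hw).map φ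
    rwa [hφ, Equiv.apply_symm_apply] at this

end InvolutiveGraph

/-! ### The equivalence -/

theorem mainTheorem3 {A : Type*} [Finite A] (Γ : InvolutiveGraph A) (hΓ : Γ.IsInverse)
    (x₀ : Γ.V) :
    List.TFAE [
      ∀ F : Set Γ.V, F.Nonempty → F.Finite → (Γ.langTo x₀ F).IsContextFree,
      (Γ.lang x₀).IsContextFree,
      Γ.IsContextFreeGraph x₀,
      ∃ (M : RealTimeDPDA (Letter A)) (hM : M.IsInverse)
        (φ : InvolutiveGraph.Iso (M.configGraph hM) Γ), φ.onV (M.configRoot hM) = x₀,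
      ∀ y₀ : Γ.V, Γ.IsContextFreeGraph y₀] := by
  tfae_have 1 → 2 := by
    intro h
    have hx₀ : Γ.langTo x₀ {x₀} = Γ.lang x₀ := by
      ext w
      constructor
      · rintro ⟨y, rfl, hw⟩
        exact hw
      · exact fun hw => ⟨x₀, rfl, hw⟩
    exact hx₀ ▸ h {x₀} (Set.singleton_nonempty x₀) (Set.finite_singleton x₀)
  tfae_have 2 → 5 := fun h => InvolutiveGraph.isContextFreeGraph_of_isContextFree hΓ h
  tfae_have 5 → 3 := fun h => h x₀
  tfae_have 3 → 4 := fun h => h.exists_iso_configGraph hΓ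
  tfae_have 4 → 1 := by
    rintro ⟨M, hM, φ, hφ⟩ F _ hF
    exact InvolutiveGraph.isContextFree_langTo_of_iso hM φ hφ hF
  tfae_finish
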